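/- Let $K$ be a field of characteristic $0$ (for instance $\mathbb C$), and let $r,\tilde r:\mathbb Z\to K$ satisfy $r(n)=r(1-n)$ and $\tilde r(n)=\tilde r(1-n)$ for all $n$. Let $\phi_n$ ($n\in\mathbb Z$) be neutral fermions, $\phi_m\phi_n+\phi_n\phi_m=(-1)^m\delta_{m,-n}$, acting on the Fock space with basis $\phi_{n_1}\cdots\phi_{n_k}|0\rangle$, $n_1>\dots>n_k\ge 0$, $k\ge 0$, where $\phi_m|0\rangle=0$ for $m<0$; let $\langle 0|$ be the linear form taking the coefficient of $|0\rangle$ in this basis, so that $\langle 0|\phi_m=0$ for $m>0$ and $\langle 0|0\rangle=1$. For odd $k\ge 1$ put $$B_k=\tfrac12\sum_{n\in\mathbb Z}(-1)^n\phi_n\phi_{k-n}\,r(n)r(n-1)\cdots r(n-k+1),\qquad \tilde B_k=\tfrac12\sum_{n\in\mathbb Z}(-1)^{n+1}\phi_n\phi_{-k-n}\,\tilde r(n+1)\tilde r(n+2)\cdots\tilde r(n+k),$$ and, with independent variables $t=(t_1,t_3,t_5,\dots)$, $t^*=(t^*_1,t^*_3,t^*_5,\dots)$, put $\tilde B(t)=\sum_{k}t_k\tilde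 B_k$ and $B(t^*)=\sum_{k}t^*_kB_k$ (sums over odd $k\ge 1$). Let $DP$ be the set of partitions with distinct parts (including the zero partition); for $\lambda=(n_1>\dots>n_k>0)$ let $l(\lambda)=k$ and $(\tilde r r)_\lambda=\prod_{i=1}^k\prod_{j=1}^{n_i}\tilde r(j)r(j)$, and let $Q_\lambda(s)$ be Schur's $Q$-function as a polynomial in $s=(s_1,s_3,\dots)$, normalized by $\sum_{n\ge0}Q_{(n)}(s)z^n=\exp\bigl(2\sum_{m\text{ odd}}s_mz^m\bigr)$. Then, as formal power series in $t$ and $t^*$, $$\langle 0|e^{\tilde B(t)}e^{-B(t^*)}|0\rangle=\sum_{\lambda\in DP}(\tilde r r)_\lambda\,2^{-l(\lambda)}\,Q_\lambda\!\left(\tfrac t2\right)Q_\lambda\!\left(\tfrac{t^*}2\right),$$ where each monomial occurs with nonzero coefficient in only finitely many terms of the sum. If $\tilde r(n)r(n)=1$ for all $n$, the left-hand side equals $\exp\bigl(\tfrac12\sum_{n\text{ odd}}n\,t_nt^*_n\bigr)$, and one has the identity of formal power series $$\exp\Bigl(\tfrac12\sum_{n=1,3,5,\dots}n\,t_nt^*_n\Bigr)=\sum_{\lambda\in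 DP}2^{-l(\lambda)}\,Q_\lambda\!\left(\tfrac t2\right)Q_\lambda\!\left(\tfrac{t^*}2\right),$$ in which again each monomial occurs with nonzero coefficient in only finitely many terms. -/

import Mathlib

noncomputable section

namespace BKP

open Finset

/-! ### Formal sums and exponentials of formal power series

The coefficient ring `A` need not be commutative: it will be a field, a polynomial ring, or the
ring of linear operators on the Fock space. -/

section FormalSeries

variable {σ ι A : Type*} [Semiring A]

/-- A family of power series is formally summable if every monomial occurs, with nonzero
coefficient, in only finitely many members of the family. -/
def FormallySummable (f : ι → MvPowerSeries σ A) : Prop :=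
  ∀ d : σ →₀ ℕ, {i | MvPowerSeries.coeff d (f i) ≠ 0}.Finite

/-- The coefficientwise sum of a (formally summable) family of power series. -/
def formalSum (f : ι → MvPowerSeries σ A) : MvPowerSeries σ A :=
  fun d => ∑ᶠ i, MvPowerSeries.coeff d (f i)

end FormalSeries

/-- `e^X = ∑_N X^N / N!` for a power series `X` without constant term whose coefficients lie in
an algebra over a field `K`. -/
def formalExp (K : Type*) {σ A : Type*} [Field K] [Ring A] [Algebra K A]
    (X : MvPowerSeries σ A) : MvPowerSeries σ A :=
  formalSum fun N : ℕ => ((N.factorial : K)⁻¹) • X ^ N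

/-- The series defining `formalExp` is formally summable when there is no constant term. -/
theorem formallySummable_exp (K : Type*) {σ A : Type*} [Field K] [Ring A] [Algebra K A]
    (X : MvPowerSeries σ A) (hX : MvPowerSeries.constantCoeff X = 0) :
    FormallySummable fun N : ℕ => ((N.factorial : K)⁻¹) • X ^ N := by
  intro d
  refine (Set.finite_le_nat d.degree).subset fun N hN => ?_
  by_contra hlt
  simp only [Set.mem_ofPred_eq, not_le] at hlt
  refine hN ?_
  have h0 : MvPowerSeries.coeff d (X ^ N) = 0 :=
    MvPowerSeries.coeff_of_lt_order
      (lt_of_lt_of_le (by exact_mod_cast hlt)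
        (MvPowerSeries.le_order_pow_of_constantCoeff_eq_zero N hX))
  change ((N.factorial : K)⁻¹) • (MvPowerSeries.coeff d (X ^ N)) = 0
  rw [h0, smul_zero]

/-! ### The times -/

/-- The odd positive integers, which label the times `t₁, t₃, t₅, …`. -/
abbrev OddIdx : Type := {n : ℕ // Odd n}

/-- The variables `t_n` (`Sum.inl n`) and `t_n^*` (`Sum.inr n`), `n` odd. -/
abbrev Times : Type := OddIdx ⊕ OddIdx

/-- The infinite sum `∑_{n odd} x_n b_n`, where `x_n` is the variable with name `x n` (either
`t_n` or `t_n^*`), with coefficients `b_n` in a ring `A`. -/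
def linearSeries {A : Type*} [Semiring A] (x : OddIdx → Times) (b : OddIdx → A) :
    MvPowerSeries Times A :=
  formalSum fun n => MvPowerSeries.monomial (Finsupp.single (x n) 1) (b n)

theorem formallySummable_linear {A : Type*} [Semiring A] (x : OddIdx → Times)
    (hx : Function.Injective x) (b : OddIdx → A) :
    FormallySummable fun n => MvPowerSeries.monomial (Finsupp.single (x n) 1) (b n) := by
  classical
  intro d
  refine Set.Subsingleton.finite fun m hm n hn => ?_
  simp only [Set.mem_ofPred_eq, MvPowerSeries.coeff_monomial, ne_eq, ite_eq_right_iff,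
    not_forall] at hm hn
  obtain ⟨hm, -⟩ := hm
  obtain ⟨hn, -⟩ := hn
  exact hx (Finsupp.single_left_injective one_ne_zero (hm.symm.trans hn))

/-! ### Neutral fermions and the Fock space -/

section Fermions

variable (K : Type*) [Field K]

/-- The right Fock space. The basis vector of a finite set `{n₁ > ⋯ > n_k ≥ 0}` is
`φ_{n₁} ⋯ φ_{n_k} |0⟩`. -/
abbrev Fock : Type _ := Finset ℕ →₀ K

/-- The sign produced when a fermion of index `a` moves past the fermions of larger index. -/
def fermiSign (a : ℕ) (S : Finset ℕ) : K := (-1) ^ (#{m ∈ S | a < m})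

/-- Multiplication by a fermion `ψ_a` on the exterior algebra with generators `ψ_0, ψ_1, …`. -/
def create (a : ℕ) : Module.End K (Fock K) :=
  Finsupp.linearCombination K fun S =>
    if a ∈ S then 0 else Finsupp.single (insert a S) (fermiSign K a S)

/-- Contraction by the dual vector of `ψ_a`. -/
def annihilate (a : ℕ) : Module.End K (Fock K) :=
  Finsupp.linearCombination K fun S =>
    if a ∈ S then Finsupp.single (S.erase a) (fermiSign K a S) else 0

/-- The neutral fermions `φ_n`, `n ∈ ℤ`, as operators on the Fock space. -/
def phi (n : ℤ) : Module.End K (Fock K) :=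
  if 0 < n then create K n.natAbs
  else if n < 0 then ((-1 : K) ^ n) • annihilate K n.natAbs
  else create K 0 + (2⁻¹ : K) • annihilate K 0

/-- The right vacuum vector `|0⟩`. -/
def vacuum : Fock K := Finsupp.single ∅ 1

/-- The left vacuum vector `⟨0|`, a linear form on the right Fock space. -/
def covacuum : Fock K →ₗ[K] K := Finsupp.lapply ∅

/-- The vacuum expectation value `T ↦ ⟨0| T |0⟩` of an operator. -/
def vev : Module.End K (Fock K) →ₗ[K] K :=
  covacuum K ∘ₗ LinearMap.applyₗ (vacuum K)

variable {K}

theorem create_single (a : ℕ) (S : Finset ℕ) :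
    create K a (Finsupp.single S 1) =
      if a ∈ S then 0 else Finsupp.single (insert a S) (fermiSign K a S) := by
  simp [create]

theorem annihilate_single (a : ℕ) (S : Finset ℕ) :
    annihilate K a (Finsupp.single S 1) =
      if a ∈ S then Finsupp.single (S.erase a) (fermiSign K a S) else 0 := by
  simp [annihilate]

theorem single_eq_smul (S : Finset ℕ) (c : K) :
    (Finsupp.single S c : Fock K) = c • Finsupp.single S 1 := by simp

theorem fermiSign_insert {a b : ℕ} {S : Finset ℕ} (hb : b ∉ S) :
    fermiSign K a (insert b S) = (if a < b then -1 else 1) * fermiSign K a S := by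
  unfold fermiSign
  rw [filter_insert]
  split_ifs with h
  · rw [card_insert_of_notMem (by simp [hb]), pow_succ]; ring
  · ring

theorem fermiSign_erase {a b : ℕ} {S : Finset ℕ} (hb : b ∈ S) :
    fermiSign K a (S.erase b) = (if a < b then -1 else 1) * fermiSign K a S := by
  have h := fermiSign_insert (K := K) (a := a) (notMem_erase b S)
  rw [insert_erase hb] at h
  rw [h]
  split_ifs <;> ring

theorem fermiSign_mul_self (a : ℕ) (S : Finset ℕ) :
    fermiSign K a S * fermiSign K a S = 1 := by
  unfold fermiSign
  rw [← mul_pow]; simp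

theorem create_create (a b : ℕ) :
    create K a * create K b + create K b * create K a = 0 := by
  refine Finsupp.lhom_ext' fun S => LinearMap.ext_ring ?_
  simp only [LinearMap.comp_apply, Finsupp.lsingle_apply, LinearMap.add_apply,
    Module.End.mul_apply, create_single, LinearMap.zero_apply]
  by_cases ha : a ∈ S <;> by_cases hb : b ∈ S <;>
    simp only [ha, hb, if_true, if_false, map_zero, add_zero, zero_add]
  · rw [single_eq_smul, map_smul, create_single]; simp [ha]
  · rw [single_eq_smul, map_smul, create_single]; simp [hb]
  · rw [single_eq_smul (insert b S), single_eq_smul (insert a S), map_smul, map_smul,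
      create_single, create_single]
    rcases lt_trichotomy a b with h | h | h
    · simp only [mem_insert, ha, hb, h.ne, h.ne', or_self, if_false, fermiSign_insert hb,
        fermiSign_insert ha, h, h.not_gt, if_true, Finsupp.smul_single, smul_eq_mul,
        Finset.insert_comm b a, ← Finsupp.single_add]
      ring_nf; simp
    · subst h; simp
    · simp only [mem_insert, ha, hb, h.ne, h.ne', or_self, if_false, fermiSign_insert hb,
        fermiSign_insert ha, h, h.not_gt, if_true, Finsupp.smul_single, smul_eq_mul,
        Finset.insert_comm b a, ← Finsupp.single_add]
      ring_nf; simp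

theorem annihilate_annihilate (a b : ℕ) :
    annihilate K a * annihilate K b + annihilate K b * annihilate K a = 0 := by
  refine Finsupp.lhom_ext' fun S => LinearMap.ext_ring ?_
  simp only [LinearMap.comp_apply, Finsupp.lsingle_apply, LinearMap.add_apply,
    Module.End.mul_apply, annihilate_single, LinearMap.zero_apply]
  by_cases ha : a ∈ S <;> by_cases hb : b ∈ S <;>
    simp only [ha, hb, if_true, if_false, map_zero, add_zero, zero_add]
  · rw [single_eq_smul (S.erase b), single_eq_smul (S.erase a), map_smul, map_smul,
      annihilate_single, annihilate_single]
    rcases lt_trichotomy a b with h | h | h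
    · simp only [mem_erase, ha, hb, h.ne, h.ne', ne_eq, not_false_eq_true, and_self, if_true,
        fermiSign_erase hb, fermiSign_erase ha, h, h.not_gt, if_false, Finsupp.smul_single,
        smul_eq_mul, Finset.erase_right_comm (a := b) (b := a), ← Finsupp.single_add]
      ring_nf; simp
    · subst h; simp
    · simp only [mem_erase, ha, hb, h.ne, h.ne', ne_eq, not_false_eq_true, and_self, if_true,
        fermiSign_erase hb, fermiSign_erase ha, h, h.not_gt, if_false, Finsupp.smul_single,
        smul_eq_mul, Finset.erase_right_comm (a := b) (b := a), ← Finsupp.single_add]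
      ring_nf; simp
  · rw [single_eq_smul, map_smul, annihilate_single]; simp [hb]
  · rw [single_eq_smul, map_smul, annihilate_single]; simp [ha]

theorem create_annihilate (a b : ℕ) :
    create K a * annihilate K b + annihilate K b * create K a = if a = b then 1 else 0 := by
  refine Finsupp.lhom_ext' fun S => LinearMap.ext_ring ?_
  rcases eq_or_ne a b with rfl | hab
  · simp only [LinearMap.comp_apply, Finsupp.lsingle_apply, LinearMap.add_apply,
      Module.End.mul_apply, create_single, annihilate_single, if_true, Module.End.one_apply]
    by_cases ha : a ∈ S
    · simp only [ha, if_true, map_zero, add_zero]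
      rw [single_eq_smul, map_smul, create_single]
      simp [insert_erase ha, fermiSign_erase ha, fermiSign_mul_self]
    · simp only [ha, if_false, map_zero, zero_add]
      rw [single_eq_smul, map_smul, annihilate_single]
      simp [erase_insert ha, fermiSign_insert ha, fermiSign_mul_self]
  · simp only [LinearMap.comp_apply, Finsupp.lsingle_apply, LinearMap.add_apply,
      Module.End.mul_apply, create_single, annihilate_single, if_neg hab, LinearMap.zero_apply]
    by_cases ha : a ∈ S <;> by_cases hb : b ∈ S <;>
      simp only [ha, hb, if_true, if_false, map_zero, add_zero, zero_add]
    · rw [single_eq_smul, map_smul, create_single]; simp [ha, hab]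
    · rw [single_eq_smul (S.erase b), single_eq_smul (insert a S), map_smul, map_smul,
        create_single, annihilate_single]
      rcases lt_or_gt_of_ne hab with h | h
      · simp only [mem_erase, mem_insert, ha, hb, and_false, or_true, if_true, if_false,
          fermiSign_erase hb, fermiSign_insert ha, h, h.not_gt, Finsupp.smul_single,
          smul_eq_mul, Finset.erase_insert_of_ne hab, ← Finsupp.single_add]
        ring_nf; simp
      · simp only [mem_erase, mem_insert, ha, hb, and_false, or_true, if_true, if_false,
          fermiSign_erase hb, fermiSign_insert ha, h, h.not_gt, Finsupp.smul_single,
          smul_eq_mul, Finset.erase_insert_of_ne hab, ← Finsupp.single_add]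
        ring_nf; simp
    · rw [single_eq_smul, map_smul, annihilate_single]; simp [hb, hab.symm]

theorem phi_of_pos {n : ℤ} (h : 0 < n) : phi K n = create K n.natAbs := by simp [phi, h]

theorem phi_of_neg {n : ℤ} (h : n < 0) :
    phi K n = ((-1 : K) ^ n) • annihilate K n.natAbs := by
  simp [phi, h, h.not_gt]

theorem phi_zero : phi K 0 = create K 0 + (2⁻¹ : K) • annihilate K 0 := by simp [phi]

theorem phi_anticomm_of_pos [CharZero K] {m : ℤ} (hm : 0 < m) (n : ℤ) :
    phi K m * phi K n + phi K n * phi K m =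
      if m = -n then ((-1 : K) ^ m) • (1 : Module.End K (Fock K)) else 0 := by
  rcases lt_trichotomy n 0 with hn | rfl | hn
  · rw [phi_of_pos hm, phi_of_neg hn, mul_smul_comm, smul_mul_assoc, ← smul_add,
      create_annihilate]
    by_cases h : m = -n
    · subst h
      simp [zpow_neg, ← inv_zpow]
    · rw [if_neg h, if_neg (by omega), smul_zero]
  · rw [phi_of_pos hm, phi_zero, if_neg (by omega), mul_add, add_mul, mul_smul_comm,
      smul_mul_assoc, add_add_add_comm, create_create, ← smul_add, create_annihilate,
      if_neg (by omega), smul_zero, add_zero]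
  · rw [phi_of_pos hm, phi_of_pos hn, create_create, if_neg (by omega)]

/-- The canonical anticommutation relations `[φ_m, φ_n]_+ = (-1)^m δ_{m,-n}`. -/
theorem phi_anticomm [CharZero K] (m n : ℤ) :
    phi K m * phi K n + phi K n * phi K m =
      if m = -n then ((-1 : K) ^ m) • (1 : Module.End K (Fock K)) else 0 := by
  rcases lt_trichotomy m 0 with hm | rfl | hm
  · rcases lt_trichotomy n 0 with hn | rfl | hn
    · rw [phi_of_neg hm, phi_of_neg hn, if_neg (by omega)]
      simp only [mul_smul_comm, smul_mul_assoc]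
      rw [smul_comm ((-1 : K) ^ n), ← smul_add, ← smul_add, annihilate_annihilate, smul_zero,
        smul_zero]
    · rw [phi_of_neg hm, phi_zero, if_neg (by omega)]
      simp only [mul_add, add_mul, mul_smul_comm, smul_mul_assoc]
      have h1 := create_annihilate (K := K) 0 m.natAbs
      rw [if_neg (by omega)] at h1
      have h2 := annihilate_annihilate (K := K) 0 m.natAbs
      refine LinearMap.ext fun v => ?_
      replace h1 := LinearMap.congr_fun h1 v
      replace h2 := LinearMap.congr_fun h2 v
      simp only [LinearMap.add_apply, LinearMap.smul_apply, LinearMap.zero_apply] at h1 h2 ⊢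
      linear_combination (norm := module)
        ((-1 : K) ^ m) • h1 + (2⁻¹ * (-1) ^ m : K) • h2
    · rw [add_comm, phi_anticomm_of_pos hn m]
      by_cases h : m = -n
      · subst h
        simp [zpow_neg, ← inv_zpow]
      · rw [if_neg h, if_neg (by omega)]
  · rcases lt_trichotomy n 0 with hn | rfl | hn
    · rw [phi_of_neg hn, phi_zero, if_neg (by omega)]
      simp only [mul_add, add_mul, mul_smul_comm, smul_mul_assoc]
      have h1 := create_annihilate (K := K) 0 n.natAbs
      rw [if_neg (by omega)] at h1
      have h2 := annihilate_annihilate (K := K) 0 n.natAbs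
      refine LinearMap.ext fun v => ?_
      replace h1 := LinearMap.congr_fun h1 v
      replace h2 := LinearMap.congr_fun h2 v
      simp only [LinearMap.add_apply, LinearMap.smul_apply, LinearMap.zero_apply] at h1 h2 ⊢
      linear_combination (norm := module)
        ((-1 : K) ^ n) • h1 + (2⁻¹ * (-1) ^ n : K) • h2
    · have h1 := create_annihilate (K := K) 0 0
      have h2 := annihilate_annihilate (K := K) 0 0
      have h3 := create_create (K := K) 0 0
      rw [if_pos rfl] at h1
      have e : phi K 0 * phi K 0 = (create K 0 * create K 0)
          + (2⁻¹ : K) • (create K 0 * annihilate K 0 + annihilate K 0 * create K 0)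
          + (2⁻¹ * 2⁻¹ : K) • (annihilate K 0 * annihilate K 0) := by
        rw [phi_zero]
        simp only [mul_add, add_mul, mul_smul_comm, smul_mul_assoc, smul_add, smul_smul]
        abel
      have h2' : annihilate K 0 * annihilate K 0 = 0 := by
        rw [← two_smul K] at h2
        exact (smul_eq_zero.mp h2).resolve_left two_ne_zero
      have h3' : create K 0 * create K 0 = 0 := by
        rw [← two_smul K] at h3
        exact (smul_eq_zero.mp h3).resolve_left two_ne_zero
      rw [e, h1, h2', h3', ← two_smul K]
      simp
    · rw [add_comm, phi_anticomm_of_pos hn 0, if_neg (by omega), if_neg (by omega)]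
  · exact phi_anticomm_of_pos hm n

/-- `φ_m |0⟩ = 0` for `m < 0`. -/
theorem phi_vacuum {m : ℤ} (hm : m < 0) : phi K m (vacuum K) = 0 := by
  rw [phi_of_neg hm, LinearMap.smul_apply, vacuum, annihilate_single]; simp

/-- `⟨0| φ_m = 0` for `m > 0`. -/
theorem covacuum_phi {m : ℤ} (hm : 0 < m) : covacuum K ∘ₗ phi K m = 0 := by
  refine Finsupp.lhom_ext' fun S => LinearMap.ext_ring ?_
  simp only [LinearMap.comp_apply, Finsupp.lsingle_apply, phi_of_pos hm, create_single,
    LinearMap.zero_apply, covacuum, Finsupp.lapply_apply]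
  split_ifs <;> simp

/-- `⟨0| 1 |0⟩ = 1`. -/
theorem vev_one : vev K 1 = 1 := by
  simp [vev, covacuum, vacuum]

theorem exists_phi_eq_zero (v : Fock K) : ∃ M : ℕ, ∀ n : ℤ, n < -M → phi K n v = 0 := by
  induction v using Finsupp.induction_linear with
  | zero => exact ⟨0, by simp⟩
  | add f g hf hg =>
    obtain ⟨M, hM⟩ := hf
    obtain ⟨N, hN⟩ := hg
    refine ⟨max M N, fun n hn => ?_⟩
    rw [map_add, hM n (by push_cast at hn; omega), hN n (by push_cast at hn; omega), add_zero]
  | single S c =>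
    refine ⟨S.sup id, fun n hn => ?_⟩
    have hS : n.natAbs ∉ S := fun h => by
      have : n.natAbs ≤ S.sup id := le_sup (f := id) h
      omega
    rw [single_eq_smul, map_smul, phi_of_neg (by omega), LinearMap.smul_apply,
      annihilate_single, if_neg hS, smul_zero, smul_zero]

theorem finite_phi_phi [CharZero K] {k : ℤ} (hk : k ≠ 0) (v : Fock K) :
    {n : ℤ | phi K n (phi K (k - n) v) ≠ 0}.Finite := by
  obtain ⟨M, hM⟩ := exists_phi_eq_zero v
  refine (Set.finite_Icc (-(M : ℤ)) (k + M)).subset fun n hn => ?_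
  by_contra hc
  refine hn ?_
  by_cases h : n < -M
  · have := congrArg (fun T => T v) (phi_anticomm (K := K) n (k - n))
    simp only [if_neg (show ¬ n = -(k - n) by omega), LinearMap.add_apply,
      Module.End.mul_apply, LinearMap.zero_apply, hM n h, map_zero, add_zero] at this
    exact this
  · rw [hM (k - n) (by simp only [Set.mem_Icc] at hc; omega), map_zero]

variable (K) in
/-- The operator `∑_{n ∈ ℤ} c(n) φ_n φ_{k-n}` on the Fock space (`k ≠ 0`), given on the basis
vectors, where the sum has only finitely many nonzero terms. -/
def bilinear (c : ℤ → K) (k : ℤ) : Module.End K (Fock K) :=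
  Finsupp.linearCombination K fun S =>
    ∑ᶠ n : ℤ, c n • phi K n (phi K (k - n) (Finsupp.single S 1))

theorem bilinear_apply [CharZero K] (c : ℤ → K) {k : ℤ} (hk : k ≠ 0) (v : Fock K) :
    bilinear K c k v = ∑ᶠ n : ℤ, c n • phi K n (phi K (k - n) v) := by
  have hfin : ∀ w : Fock K,
      (Function.support fun n : ℤ => c n • phi K n (phi K (k - n) w)).Finite := fun w =>
    (finite_phi_phi hk w).subset fun n hn h => hn (by simp [h])
  induction v using Finsupp.induction_linear with
  | zero => simp
  | add f g hf hg =>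
    rw [map_add, hf, hg, ← finsum_add_distrib (hfin f) (hfin g)]
    simp
  | single S a =>
    rw [single_eq_smul, map_smul, bilinear, Finsupp.linearCombination_single, one_smul,
      smul_finsum' _ (hfin _)]
    simp only [map_smul, smul_comm a]

/-- `B_k = ½ ∑_n (-1)^n φ_n φ_{k-n} r(n) r(n-1) ⋯ r(n-k+1)`, `k` odd and positive. -/
def B (r : ℤ → K) (k : OddIdx) : Module.End K (Fock K) :=
  bilinear K (fun n => 2⁻¹ * ((-1) ^ n * ∏ i ∈ range k.1, r (n - i))) k.1

/-- `B̃_k = ½ ∑_n (-1)^(n+1) φ_n φ_{-k-n} r̃(n+1) r̃(n+2) ⋯ r̃(n+k)`, `k` odd and positive. -/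
def Btilde (rt : ℤ → K) (k : OddIdx) : Module.End K (Fock K) :=
  bilinear K (fun n => 2⁻¹ * ((-1) ^ (n + 1) * ∏ i ∈ range k.1, rt (n + (i + 1)))) (-k.1)

/-- The vacuum expectation value `⟨0| e^{B̃(t)} e^{-B(t^*)} |0⟩`, a formal power series in the
times, where `B̃(t) = ∑ t_k B̃_k` and `B(t^*) = ∑ t_k^* B_k`. -/
def vacuumExpectation (rt r : ℤ → K) : MvPowerSeries Times K := fun d =>
  vev K (MvPowerSeries.coeff d
    (formalExp K (linearSeries Sum.inl (Btilde rt)) *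
      formalExp K (-linearSeries Sum.inr (B r))))

end Fermions

/-! ### Projective Schur functions -/

section SchurQ

variable (K : Type*) [Field K]

/-- The polynomials `q_n` in times `s = (s₁, s₃, …)`, given by
`∑ q_n(s) z^n = exp (2 ∑_{m odd} s_m z^m)`. For `s_m = p_m(x) / m`, with `p_m` the power sums, the
right hand side is `∏ (1 + z x_i) / (1 - z x_i)`. -/
def q (n : ℕ) : MvPolynomial OddIdx K :=
  PowerSeries.coeff n (formalExp K
    (PowerSeries.mk fun m => if h : Odd m then 2 * MvPolynomial.X ⟨m, h⟩ else 0))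

/-- Schur's two-row functions `Q_{(a,b)}`, `a > b ≥ 0`. -/
def Q₂ (a b : ℕ) : MvPolynomial OddIdx K :=
  q K a * q K b + 2 * ∑ i ∈ Icc 1 b, (-1) ^ i * (q K (a + i) * q K (b - i))

/-- The Pfaffian of the skew-symmetric matrix with entries `M(l_i, l_j)` above the diagonal, where
`l` is a list of even length, by expansion along the first row. (Lists of odd length give `0`.) -/
def pfaffian {ι R : Type*} [CommRing R] (M : ι → ι → R) : List ι → R
  | [] => 1
  | i :: l => ∑ j : Fin l.length, (-1) ^ (j : ℕ) * (M i (l.get j) * pfaffian M (l.eraseIdx j))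
termination_by l => l.length
decreasing_by simp [List.length_eraseIdx]

end SchurQ

/-- Partitions with distinct parts: strictly decreasing finite sequences of positive integers. The
zero partition is the empty sequence. -/
@[ext]
structure StrictPartition where
  parts : List ℕ
  decreasing : parts.Pairwise (· > ·)
  pos : ∀ n ∈ parts, 0 < n

namespace StrictPartition

variable {K : Type*} [Field K] (p : StrictPartition)

/-- `l(λ)`, the number of parts. -/
def length : ℕ := p.parts.length

variable (K) in
/-- The projective Schur function `Q_λ(s)` as a polynomial in `s₁, s₃, …`: the Pfaffian of
`Q_{(λ_i, λ_j)}`, where a zero part is appended when the number of parts is odd. -/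
def Q : MvPolynomial OddIdx K :=
  pfaffian (Q₂ K) (if Even p.length then p.parts else p.parts ++ [0])

variable (K) in
/-- `Q_λ(t/2)` (for `x = Sum.inl`) and `Q_λ(t^*/2)` (for `x = Sum.inr`). -/
def halfQ (x : OddIdx → Times) : MvPowerSeries Times K :=
  MvPolynomial.aeval (fun n => (2⁻¹ : K) • MvPowerSeries.X (x n)) (p.Q K)

variable (K) in
/-- `2^{-l(λ)} Q_λ(t/2) Q_λ(t^*/2)`. -/
def cauchyTerm : MvPowerSeries Times K :=
  ((2⁻¹ : K) ^ p.length) • (p.halfQ K Sum.inl * p.halfQ K Sum.inr)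

/-- `r_λ = ∏_i r(1) r(2) ⋯ r(n_i)` for `λ = (n_1, …, n_k)`. -/
def content (r : ℤ → K) : K :=
  (p.parts.map fun n : ℕ => ∏ j ∈ Icc 1 n, r (j : ℤ)).prod

end StrictPartition

/-- `exp (½ ∑_{n odd} n t_n t_n^*)`. -/
def cauchyKernel (K : Type*) [Field K] : MvPowerSeries Times K :=
  formalExp K (formalSum fun n : OddIdx =>
    ((2⁻¹ : K) * n.1) • (MvPowerSeries.X (Sum.inl n) * MvPowerSeries.X (Sum.inr n)))

end BKP

end

noncomputable section

namespace BKP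

open Finset

/-! Insert a resolution of the identity between the two exponentials. The Fock space carries a
symmetric bilinear form with orthogonal basis vectors (`pairing`; norm `1/2` when the zero mode is
occupied, else `1`) for which `φ_n` is adjoint to `(-1)^n φ_{-n}`. The adjoint of `-B_k` is then
`B̃_k` built from the same function `r`, so the component of `e^{-B(t*)}|0⟩` along the basis vector
`|S⟩` is, up to that norm, the amplitude `⟨0|e^{B̃(t*)}|S⟩`. The vacuum expectation becomes a sum
over finite sets `S` of products of two amplitudes of the same kind (`coeff_vacuumExpectation`).

To compute an amplitude, use `[B̃_k, φ_n] = r(n)⋯r(n-k+1) φ_{n-k}`. Conjugation by `e^{B̃(t)}`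
therefore replaces `φ_n` by a combination of the `φ_{n-|d|}`, with scalar part read off from `exp(∑
t_k)`, where `t_k` has weight `k` and `|d|` is the weight of the exponent `d` (`formalExp_mul_phi`).
As `B̃_k|0⟩ = 0`, the amplitude is the vacuum expectation of a product of such combinations, hence a
Pfaffian by Wick's theorem (`wick`). The symmetry `r(n) = r(1-n)` makes the content factors
independent of the summation index in the two-point function, which is thus `1/2` times a content
times `Q_{(a,b)}(t/2)` (`twoPointSeries_eq`). Odd `S` give zero. Even `S` correspond to strict
partitions, the element `0` serving to correct the parity, and the powers of `2` combine to
`2^{-l(λ)}`.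

For `r = r̃ = 1` the operators form a Heisenberg algebra, `[B̃_k, B_l] = -(k/2) δ_{kl}`
(`heisenberg`), and the vacuum expectation of the two exponentials is the exponential of the central
commutator (`vacuumExpectation_one`). Comparison with the first formula gives the Cauchy identity.
The case `r̃ r = 1` follows because the sum over partitions involves only the product `r̃ r`. -/

theorem coeff_mul_swap {σ A : Type*} [Semiring A] [DecidableEq σ] (P Q : MvPowerSeries σ A) (d : σ →₀ ℕ) :
    MvPowerSeries.coeff d (P * Q) =
      ∑ p ∈ antidiagonal d, MvPowerSeries.coeff p.2 P * MvPowerSeries.coeff p.1 Q := by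
  rw [MvPowerSeries.coeff_mul]
  exact Finsupp.sum_antidiagonal_swap d fun a b =>
    MvPowerSeries.coeff a P * MvPowerSeries.coeff b Q

/-! ### Formal exponentials and conjugation by them. -/

section Exponential

variable {K σ A : Type*} [Field K] [Ring A] [Algebra K A]

theorem coeff_smul_field (c : K) (d : σ →₀ ℕ) (X : MvPowerSeries σ A) :
    MvPowerSeries.coeff d (c • X) = c • MvPowerSeries.coeff d X := rfl

/-- The `m`-th partial sum of the exponential series. -/
def truncExp (K : Type*) {A : Type*} [Field K] [Ring A] [Algebra K A] (m : ℕ) (X : A) : A :=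
  ∑ N ∈ range m, ((N.factorial : K)⁻¹) • X ^ N

theorem coeff_pow_eq_zero {X : MvPowerSeries σ A} (hX : MvPowerSeries.constantCoeff X = 0)
    {d : σ →₀ ℕ} {N : ℕ} (h : d.degree < N) : MvPowerSeries.coeff d (X ^ N) = 0 :=
  MvPowerSeries.coeff_of_lt_order (lt_of_lt_of_le (by exact_mod_cast h)
    (MvPowerSeries.le_order_pow_of_constantCoeff_eq_zero N hX))

theorem coeff_formalExp {X : MvPowerSeries σ A} (hX : MvPowerSeries.constantCoeff X = 0)
    {d : σ →₀ ℕ} {m : ℕ} (h : d.degree < m) :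
    MvPowerSeries.coeff d (formalExp K X) = MvPowerSeries.coeff d (truncExp K m X) := by
  rw [truncExp, map_sum]
  change ∑ᶠ N : ℕ, MvPowerSeries.coeff d (((N.factorial : K)⁻¹) • X ^ N) = _
  refine finsum_eq_sum_of_support_subset _ fun N hN => ?_
  by_contra hlt
  refine hN ?_
  simp only [coe_range, Set.mem_Iio, not_lt] at hlt
  simp only [coeff_smul_field]
  rw [coeff_pow_eq_zero hX (h.trans_le hlt), smul_zero]

theorem degree_le_of_mem_antidiagonal [DecidableEq σ] {d : σ →₀ ℕ}
    {p : (σ →₀ ℕ) × (σ →₀ ℕ)} (hp : p ∈ antidiagonal d) :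
    p.1.degree ≤ d.degree ∧ p.2.degree ≤ d.degree := by
  rw [HasAntidiagonal.mem_antidiagonal] at hp
  subst hp
  simp [map_add]

theorem coeff_formalExp_mul_formalExp {X Y : MvPowerSeries σ A}
    (hX : MvPowerSeries.constantCoeff X = 0) (hY : MvPowerSeries.constantCoeff Y = 0)
    {d : σ →₀ ℕ} {m : ℕ} (h : d.degree < m) :
    MvPowerSeries.coeff d (formalExp K X * formalExp K Y) =
      MvPowerSeries.coeff d (truncExp K m X * truncExp K m Y) := by
  classical
  rw [MvPowerSeries.coeff_mul, MvPowerSeries.coeff_mul]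
  refine sum_congr rfl fun p hp => ?_
  obtain ⟨h1, h2⟩ := degree_le_of_mem_antidiagonal hp
  rw [coeff_formalExp hX (h1.trans_lt h), coeff_formalExp hY (h2.trans_lt h)]

/-- The terms beyond `P` itself are written with a factor `X` on the far right, so that they vanish
once `X` kills the vacuum. -/
theorem coeff_mul_formalExp {P X : MvPowerSeries σ A}
    (hX : MvPowerSeries.constantCoeff X = 0) (d : σ →₀ ℕ) :
    MvPowerSeries.coeff d (P * formalExp K X) = MvPowerSeries.coeff d P +
      ∑ N ∈ range d.degree,
        (((N + 1).factorial : K)⁻¹) • MvPowerSeries.coeff d (P * X ^ N * X) := by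
  classical
  have e : MvPowerSeries.coeff d (P * formalExp K X) =
      MvPowerSeries.coeff d (P * truncExp K (d.degree + 1) X) := by
    rw [MvPowerSeries.coeff_mul, MvPowerSeries.coeff_mul]
    refine sum_congr rfl fun p hp => ?_
    rw [coeff_formalExp hX
      ((degree_le_of_mem_antidiagonal hp).2.trans_lt (Nat.lt_succ_self _))]
  rw [e, truncExp, sum_range_succ', mul_add, mul_sum, map_add, map_sum, add_comm]
  congr 1
  · simp
  · refine sum_congr rfl fun N _ => ?_
    rw [mul_smul_comm, coeff_smul_field, pow_succ, mul_assoc]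

/-- The series obtained from a scalar series by attaching the operator `T d` to the monomial
with exponent `d`. -/
def decorate (T : (σ →₀ ℕ) → A) : MvPowerSeries σ K →ₗ[K] MvPowerSeries σ A where
  toFun g := fun d => MvPowerSeries.coeff d g • T d
  map_add' g h := by
    ext d
    exact add_smul (MvPowerSeries.coeff d g) (MvPowerSeries.coeff d h) (T d)
  map_smul' c g := by
    ext d
    exact mul_smul c (MvPowerSeries.coeff d g) (T d)

theorem coeff_decorate (T : (σ →₀ ℕ) → A) (g : MvPowerSeries σ K) (d : σ →₀ ℕ) :
    MvPowerSeries.coeff d (decorate T g) = MvPowerSeries.coeff d g • T d := rfl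

/-- Left multiplication by `X` is the sum of `ad X` and right multiplication by `X`, which commute;
this is the binomial theorem for that sum. By `hXL`, `ad X` acts on decorated series as
multiplication by the scalar series `L`. -/
theorem pow_mul_decorate {T : (σ →₀ ℕ) → A} {X : MvPowerSeries σ A} {L : MvPowerSeries σ K}
    (hXL : ∀ g, X * decorate T g = decorate T (L * g) + decorate T g * X) (N : ℕ)
    (g : MvPowerSeries σ K) :
    X ^ N * decorate T g =
      ∑ p ∈ antidiagonal N, N.choose p.1 • (decorate T (L ^ p.1 * g) * X ^ p.2) := by
  let lX : Module.End K (MvPowerSeries σ A) := LinearMap.mulLeft K X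
  let rX : Module.End K (MvPowerSeries σ A) := LinearMap.mulRight K X
  have hcomm : Commute (lX - rX) rX := by
    have : Commute lX rX := LinearMap.commute_mulLeft_right X X
    exact this.sub_left (Commute.refl rX)
  have had : ∀ i, ((lX - rX) ^ i) (decorate T g) = decorate T (L ^ i * g) := by
    intro i
    induction i with
    | zero => simp
    | succ i ih =>
      rw [pow_succ', Module.End.mul_apply, ih]
      simp only [lX, rX, LinearMap.sub_apply, LinearMap.mulLeft_apply, LinearMap.mulRight_apply]
      rw [hXL, add_sub_cancel_right, pow_succ', mul_assoc]
  have hr : ∀ j Y, (rX ^ j) Y = Y * X ^ j := by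
    intro j Y
    simp [rX]
  have hl : (lX ^ N) (decorate T g) = X ^ N * decorate T g := by simp [lX]
  rw [← hl, show lX = (lX - rX) + rX by abel, hcomm.add_pow', LinearMap.sum_apply]
  refine sum_congr rfl fun p _ => ?_
  rw [(hcomm.pow_pow p.1 p.2).eq, LinearMap.smul_apply, Module.End.mul_apply, had, hr]

/-- This is `e^X Y e^{-X} = e^{ad X} Y` with the inverse exponential moved to the other side, and
`ad X` acting as multiplication by `L`. -/
theorem formalExp_mul_decorate [CharZero K] {T : (σ →₀ ℕ) → A} {X : MvPowerSeries σ A}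
    {L : MvPowerSeries σ K} (hX : MvPowerSeries.constantCoeff X = 0)
    (hL : MvPowerSeries.constantCoeff L = 0)
    (hXL : ∀ g, X * decorate T g = decorate T (L * g) + decorate T g * X) :
    formalExp K X * decorate T (1 : MvPowerSeries σ K) = decorate T (formalExp K L) * formalExp K X := by
  classical
  ext d
  set m := d.degree + 1 with hm
  have hd : d.degree < m := Nat.lt_succ_self _
  have e1 : MvPowerSeries.coeff d (formalExp K X * decorate T (1 : MvPowerSeries σ K)) =
      MvPowerSeries.coeff d (truncExp K m X * decorate T (1 : MvPowerSeries σ K)) := by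
    rw [MvPowerSeries.coeff_mul, MvPowerSeries.coeff_mul]
    refine sum_congr rfl fun p hp => ?_
    rw [coeff_formalExp hX ((degree_le_of_mem_antidiagonal hp).1.trans_lt hd)]
  have e2 : MvPowerSeries.coeff d (decorate T (formalExp K L) * formalExp K X) =
      MvPowerSeries.coeff d (decorate T (truncExp K m L) * truncExp K m X) := by
    rw [MvPowerSeries.coeff_mul, MvPowerSeries.coeff_mul]
    refine sum_congr rfl fun p hp => ?_
    obtain ⟨h1, h2⟩ := degree_le_of_mem_antidiagonal hp
    rw [coeff_decorate, coeff_decorate, coeff_formalExp hX (h2.trans_lt hd),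
      coeff_formalExp hL (h1.trans_lt hd)]
  let F : ℕ × ℕ → MvPowerSeries σ A := fun p =>
    (((p.1.factorial : K)⁻¹) • decorate T (L ^ p.1)) * (((p.2.factorial : K)⁻¹) • X ^ p.2)
  have h1 : truncExp K m X * decorate T (1 : MvPowerSeries σ K) = ∑ N ∈ range m, ∑ p ∈ antidiagonal N, F p := by
    rw [truncExp, sum_mul]
    refine sum_congr rfl fun N _ => ?_
    rw [smul_mul_assoc, pow_mul_decorate hXL, smul_sum]
    refine sum_congr rfl fun p hp => ?_
    rw [HasAntidiagonal.mem_antidiagonal] at hp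
    simp only [F, mul_one]
    rw [smul_mul_smul_comm, ← Nat.cast_smul_eq_nsmul K, smul_smul]
    congr 1
    subst hp
    rw [Nat.cast_add_choose]
    have := Nat.factorial_ne_zero (p.1 + p.2)
    field_simp
  have h2 : decorate T (truncExp K m L) * truncExp K m X = ∑ p ∈ range m ×ˢ range m, F p := by
    simp only [truncExp, map_sum, map_smul]
    rw [sum_mul_sum, sum_product]
  -- The left side sums over the triangle `p.1 + p.2 < m`, the right side over the square. The
  -- excess terms have order at least `m`, above the degree of `d`.
  have hF : ∀ p : ℕ × ℕ, m ≤ p.1 + p.2 → MvPowerSeries.coeff d (F p) = 0 := by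
    intro p hp
    rw [MvPowerSeries.coeff_mul]
    refine sum_eq_zero fun u hu => ?_
    rw [HasAntidiagonal.mem_antidiagonal] at hu
    have hdeg : u.1.degree + u.2.degree = d.degree := by rw [← hu, map_add]
    simp only [coeff_smul_field, coeff_decorate]
    by_cases h : u.1.degree < p.1
    · rw [coeff_pow_eq_zero (A := K) hL h]; simp
    · rw [coeff_pow_eq_zero hX (d := u.2) (N := p.2) (by omega)]; simp
  rw [e1, e2, h1, h2, map_sum, map_sum]
  simp only [map_sum]
  have hbox : ∑ p ∈ range m ×ˢ range m, MvPowerSeries.coeff d (F p) =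
      ∑ p ∈ range m ×ˢ range m with p.1 + p.2 < m, MvPowerSeries.coeff d (F p) := by
    refine (sum_filter_of_ne fun p _ hp => ?_).symm
    by_contra hlt
    exact hp (hF p (not_lt.mp hlt))
  rw [hbox, ← sum_fiberwise_of_maps_to (s := {p ∈ range m ×ˢ range m | p.1 + p.2 < m})
    (t := range m) (g := fun p => p.1 + p.2) (fun p hp => by simpa using (mem_filter.mp hp).2)]
  refine sum_congr rfl fun N hN => sum_congr ?_ fun _ _ => rfl
  ext p
  simp only [mem_range] at hN
  simp only [HasAntidiagonal.mem_antidiagonal, mem_filter, mem_product, mem_range]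
  omega

end Exponential

/-! ### Commutators of the bilinear operators with fermions; the creation–annihilation splitting. -/

section Operators

variable {K : Type*} [Field K]

theorem phi_phi_apply [CharZero K] (m n : ℤ) (v : Fock K) :
    phi K m (phi K n v) = (if m = -n then (-1 : K) ^ m else 0) • v - phi K n (phi K m v) := by
  have := LinearMap.congr_fun (phi_anticomm (K := K) m n) v
  rw [LinearMap.add_apply, Module.End.mul_apply, Module.End.mul_apply] at this
  rw [eq_sub_iff_add_eq, this]
  split_ifs <;> simp

theorem neg_one_zpow_mul_self (n : ℤ) : (-1 : K) ^ n * (-1) ^ n = 1 := by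
  rw [← mul_zpow]; simp

theorem neg_one_zpow_neg (n : ℤ) : (-1 : K) ^ (-n) = (-1) ^ n := by
  rw [zpow_neg, ← inv_zpow]; norm_num

theorem finite_support_bilinear [CharZero K] (c : ℤ → K) {k : ℤ} (hk : k ≠ 0) (v : Fock K) :
    (Function.support fun n : ℤ => c n • phi K n (phi K (k - n) v)).Finite :=
  (finite_phi_phi hk v).subset fun n hn h => hn (by simp [h])

/-- Moving `φ_n` to the left past both factors produces two contractions: the inner factor
contributes at `m = k + n` only, the outer one at `m = -n` only. -/
theorem bilinear_phi_apply [CharZero K] (c : ℤ → K) {k : ℤ} (hk : k ≠ 0) (n : ℤ) (v : Fock K) :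
    bilinear K c k (phi K n v) =
      ((-1) ^ n * (c (k + n) - c (-n))) • phi K (k + n) v + phi K n (bilinear K c k v) := by
  rw [bilinear_apply c hk, bilinear_apply c hk, map_finsum _ (finite_support_bilinear c hk v)]
  have hterm : ∀ m : ℤ, c m • phi K m (phi K (k - m) (phi K n v)) =
      ((if m = k + n then ((-1) ^ n * c (k + n)) • phi K (k + n) v else 0) +
       (if m = -n then -(((-1) ^ n * c (-n)) • phi K (k + n) v) else 0)) +
        phi K n (c m • phi K m (phi K (k - m) v)) := by
    intro m
    rw [phi_phi_apply (k - m) n, map_sub, map_smul, phi_phi_apply m n (phi K (k - m) v),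
      map_smul, smul_sub, smul_sub, smul_smul, smul_smul]
    have h1 : (c m * if k - m = -n then (-1 : K) ^ (k - m) else 0) • phi K m v =
        if m = k + n then ((-1) ^ n * c (k + n)) • phi K (k + n) v else 0 := by
      by_cases h : m = k + n
      · subst h
        rw [if_pos (by ring), if_pos rfl, show k - (k + n) = -n by ring, neg_one_zpow_neg,
          mul_comm]
      · rw [if_neg (by omega), if_neg h, mul_zero, zero_smul]
    have h2 : (c m * if m = -n then (-1 : K) ^ m else 0) • phi K (k - m) v =
        if m = -n then ((-1) ^ n * c (-n)) • phi K (k + n) v else 0 := by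
      by_cases h : m = -n
      · subst h
        rw [if_pos rfl, if_pos rfl, neg_one_zpow_neg, sub_neg_eq_add, mul_comm]
      · rw [if_neg h, if_neg h, mul_zero, zero_smul]
    rw [h1, h2]
    split_ifs <;> module
  have hone : ∀ (a : ℤ) (w : Fock K),
      (Function.support fun m : ℤ => if m = a then w else 0).Finite := fun a w =>
    (Set.finite_singleton a).subset fun m hm => by
      by_contra h
      exact hm (if_neg h)
  have hval : ∀ (a : ℤ) (w : Fock K), (∑ᶠ m : ℤ, if m = a then w else 0) = w := fun a w => by
    rw [finsum_eq_single _ a fun m hm => if_neg hm, if_pos rfl]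
  have hv : (Function.support fun m : ℤ => phi K n (c m • phi K m (phi K (k - m) v))).Finite :=
    (finite_support_bilinear c hk v).subset fun m hm h => hm (by
      change phi K n (c m • phi K m (phi K (k - m) v)) = 0
      exact (congrArg (phi K n) h).trans (map_zero _))
  simp only [hterm]
  rw [finsum_add_distrib ((hone _ _).union (hone _ _) |>.subset (Function.support_add _ _)) hv,
    finsum_add_distrib (hone _ _) (hone _ _), hval, hval]
  congr 1
  module

/-- `r(n) r(n-1) ⋯ r(n-k+1)`. -/
def fallingProd (r : ℤ → K) (n : ℤ) (k : ℕ) : K := ∏ i ∈ range k, r (n - i)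

theorem fallingProd_add (r : ℤ → K) (n : ℤ) (k l : ℕ) :
    fallingProd r n (k + l) = fallingProd r n k * fallingProd r (n - k) l := by
  rw [fallingProd, prod_range_add]
  congr 1
  refine prod_congr rfl fun i _ => ?_
  congr 1
  push_cast
  ring

theorem fallingProd_natCast (r : ℤ → K) (n : ℕ) :
    fallingProd r n n = ∏ j ∈ Icc 1 n, r (j : ℤ) := by
  rw [fallingProd, ← prod_range_reflect, range_eq_Ico, prod_Ico_eq_prod_range,
    ← Ico_add_one_right_eq_Icc, prod_Ico_eq_prod_range]
  simp only [Nat.sub_zero, Nat.add_sub_cancel]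
  refine prod_congr rfl fun j hj => ?_
  rw [mem_range] at hj
  congr 1
  push_cast [show 0 + j ≤ n - 1 by omega, show 1 ≤ n by omega]
  omega

/-- The symmetry of `rt` identifies the products in the two contractions, and oddness of `k` makes
them add rather than cancel; this absorbs the factor `1/2` of the definition. -/
theorem Btilde_phi_apply [CharZero K] (rt : ℤ → K) (hrt : ∀ n, rt n = rt (1 - n)) (k : OddIdx) (n : ℤ)
    (v : Fock K) :
    Btilde rt k (phi K n v) =
      fallingProd rt n k.1 • phi K (n - k.1) v + phi K n (Btilde rt k v) := by
  obtain ⟨k, hk⟩ := k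
  have hk0 : (-(k : ℤ)) ≠ 0 := by
    have := hk.pos
    omega
  have hodd : (-1 : K) ^ (-(k : ℤ)) = -1 := by
    rw [neg_one_zpow_neg, zpow_natCast, hk.neg_one_pow]
  rw [Btilde, bilinear_phi_apply _ hk0]
  congr 1
  rw [show -(k : ℤ) + n = n - k by ring]
  congr 1
  have h1 : ∏ i ∈ range k, rt (n - k + (i + 1)) = fallingProd rt n k := by
    rw [fallingProd, ← prod_range_reflect]
    refine prod_congr rfl fun j hj => ?_
    rw [mem_range] at hj
    congr 1
    push_cast [show j ≤ k - 1 by omega, show 1 ≤ k by omega]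
    ring
  have h2 : ∏ i ∈ range k, rt (-n + (i + 1)) = fallingProd rt n k := by
    refine prod_congr rfl fun j _ => ?_
    rw [hrt]
    congr 1
    ring
  rw [h1, h2, zpow_add₀ (by norm_num), zpow_add₀ (by norm_num), neg_one_zpow_neg,
    sub_eq_add_neg n, zpow_add₀ (by norm_num), hodd]
  have := neg_one_zpow_mul_self (K := K) n
  linear_combination (fallingProd rt n k) * this

/-- The two fermion indices have negative sum, so one of them is negative, and since the sum is
nonzero the fermions anticommute. -/
theorem Btilde_vacuum [CharZero K] (rt : ℤ → K) (k : OddIdx) : Btilde rt k (vacuum K) = 0 := by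
  obtain ⟨k, hk⟩ := k
  have hpos := hk.pos
  have hk0 : (-(k : ℤ)) ≠ 0 := by omega
  rw [Btilde, bilinear_apply _ hk0]
  dsimp only
  refine finsum_eq_zero_of_forall_eq_zero fun n => ?_
  by_cases h : -(k : ℤ) - n < 0
  · rw [phi_vacuum h, map_zero, smul_zero]
  · rw [phi_phi_apply, if_neg (by omega), phi_vacuum (m := n) (by omega), map_zero, zero_smul,
      sub_zero, smul_zero]

/-- The part of `φ_n` that creates. -/
def creation (n : ℤ) : Module.End K (Fock K) := if 0 ≤ n then create K n.natAbs else 0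

/-- The part of `φ_n` that annihilates the vacuum. -/
def annihilation (n : ℤ) : Module.End K (Fock K) :=
  if n < 0 then phi K n else if n = 0 then (2⁻¹ : K) • annihilate K 0 else 0

theorem creation_add_annihilation (n : ℤ) : creation n + annihilation n = phi K n := by
  rcases lt_trichotomy n 0 with h | rfl | h
  · simp [creation, annihilation, h, h.not_ge]
  · simp [creation, annihilation, phi_zero]
  · simp [creation, annihilation, h.le, h.not_gt, h.ne', phi_of_pos h]

theorem covacuum_creation (n : ℤ) (v : Fock K) : covacuum K (creation n v) = 0 := by
  rw [creation]
  split_ifs with h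
  · suffices covacuum K ∘ₗ create K n.natAbs = 0 from LinearMap.congr_fun this v
    refine Finsupp.lhom_ext' fun S => LinearMap.ext_ring ?_
    simp only [LinearMap.comp_apply, Finsupp.lsingle_apply, create_single,
      LinearMap.zero_apply, covacuum, Finsupp.lapply_apply]
    split_ifs <;> simp
  · simp

theorem annihilation_of_pos {n : ℤ} (h : 0 < n) : annihilation (K := K) n = 0 := by
  rw [annihilation, if_neg h.not_gt, if_neg h.ne']

theorem annihilation_zero : annihilation (K := K) 0 = (2⁻¹ : K) • annihilate K 0 := by
  simp [annihilation]

theorem annihilation_of_neg {n : ℤ} (h : n < 0) : annihilation (K := K) n = phi K n := by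
  rw [annihilation, if_pos h]

theorem annihilation_vacuum (n : ℤ) : annihilation n (vacuum K) = 0 := by
  rcases lt_trichotomy n 0 with h | rfl | h
  · rw [annihilation_of_neg h, phi_vacuum h]
  · rw [annihilation_zero, LinearMap.smul_apply, vacuum, annihilate_single]; simp
  · rw [annihilation_of_pos h, LinearMap.zero_apply]

/-- The two-point function `⟨0| φ_m φ_n |0⟩`. -/
def twoPoint (K : Type*) [Field K] (m n : ℤ) : K :=
  if m = -n then (if n = 0 then 2⁻¹ else if 0 < n then (-1) ^ n else 0) else 0

/-- The scalar input of Wick's theorem. The zero mode enters the annihilation part with its `1/2`,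
whence the value `1/2` at `m = n = 0`. -/
theorem annihilation_anticomm [CharZero K] (m n : ℤ) :
    annihilation m * phi K n + phi K n * annihilation m =
      algebraMap K (Module.End K (Fock K)) (twoPoint K m n) := by
  rw [Algebra.algebraMap_eq_smul_one, twoPoint]
  rcases lt_trichotomy m 0 with h | rfl | h
  · rw [annihilation_of_neg h, phi_anticomm]
    by_cases hmn : m = -n
    · subst hmn
      rw [if_pos rfl, if_pos rfl, if_neg (by omega), if_pos (by omega), neg_one_zpow_neg]
    · rw [if_neg hmn, if_neg hmn, zero_smul]
  · rw [annihilation_zero, smul_mul_assoc, mul_smul_comm, ← smul_add]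
    rcases lt_trichotomy n 0 with hn | rfl | hn
    · rw [phi_of_neg hn, smul_mul_assoc, mul_smul_comm, ← smul_add, annihilate_annihilate,
        if_neg (by omega)]
      simp
    · have h1 := create_annihilate (K := K) 0 0
      have h2 := annihilate_annihilate (K := K) 0 0
      rw [if_pos rfl] at h1
      rw [phi_zero, mul_add, add_mul, smul_mul_assoc, mul_smul_comm, add_add_add_comm,
        ← smul_add, h2, smul_zero, add_zero, add_comm, h1]
      simp
    · have h1 := create_annihilate (K := K) n.natAbs 0
      rw [if_neg (by omega)] at h1
      rw [phi_of_pos hn, add_comm, h1, if_neg (by omega)]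
      simp
  · rw [annihilation_of_pos h]
    split_ifs <;> first | omega | simp

/-- Each new fermion has a larger index than all those already present, so no sign arises. The index
`0` can only act directly on the vacuum, where the annihilating half of `φ_0` gives nothing. -/
theorem prod_phi_vacuum (l : List ℕ) (hl : l.Pairwise (· > ·)) :
    (l.map fun n : ℕ => phi K n).prod (vacuum K) = Finsupp.single l.toFinset 1 := by
  induction l with
  | nil => simp [vacuum]
  | cons n l ih =>
    rw [List.pairwise_cons] at hl
    rw [List.map_cons, List.prod_cons, Module.End.mul_apply, ih hl.2]
    have hn : n ∉ l.toFinset := fun h => lt_irrefl n (hl.1 n (List.mem_toFinset.mp h))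
    have hs : fermiSign K n l.toFinset = 1 := by
      rw [fermiSign, filter_false_of_mem, card_empty, pow_zero]
      exact fun m hm => (hl.1 m (List.mem_toFinset.mp hm)).not_gt
    rcases Nat.eq_zero_or_pos n with rfl | hpos
    · have : l = [] := List.eq_nil_iff_forall_not_mem.mpr fun m hm => by
        have := hl.1 m hm
        omega
      subst this
      simp [phi_zero, create_single, annihilate_single, fermiSign]
    · rw [phi_of_pos (by exact_mod_cast hpos), Int.natAbs_natCast, create_single, if_neg hn, hs,
        List.toFinset_cons]

end Operators

/-! ### Pfaffians and Wick's theorem. -/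

section Pfaffian

variable {ι R : Type*} [CommRing R]

theorem pfaffian_cons (M : ι → ι → R) (i : ι) (l : List ι) :
    pfaffian M (i :: l) =
      ∑ j : Fin l.length, (-1) ^ (j : ℕ) * (M i (l.get j) * pfaffian M (l.eraseIdx j)) := by
  rw [pfaffian]

theorem pfaffian_nil (M : ι → ι → R) : pfaffian M [] = 1 := by
  rw [pfaffian]

theorem prod_map_eraseIdx {S : Type*} [CommMonoid S] (f : ι → S) (l : List ι)
    (j : Fin l.length) : f (l.get j) * ((l.eraseIdx j).map f).prod = (l.map f).prod := by
  rw [← List.eraseIdx_map]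
  simpa using List.CommMonoid.mul_prod_eraseIdx (l := l.map f) (i := j) (by simp)

/-- Every index is used once in each term of the Pfaffian, and each term has `l.length / 2` factors.
For odd length both sides vanish, so the rounding is harmless. -/
theorem pfaffian_smul (M : ι → ι → R) (c : R) (f : ι → R) :
    ∀ (n : ℕ) (l : List ι), l.length = n → pfaffian (fun i j => c * (f i * f j) * M i j) l =
      c ^ (l.length / 2) * (l.map f).prod * pfaffian M l := by
  intro n
  induction n using Nat.strong_induction_on with
  | _ n ih =>
    rintro (_ | ⟨i, l⟩) hn
    · simp [pfaffian_nil]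
    · rw [pfaffian_cons, pfaffian_cons, mul_sum]
      refine sum_congr rfl fun j _ => ?_
      have hj := j.2
      rw [List.length_cons] at hn
      have hlen : (l.eraseIdx j).length = l.length - 1 := List.length_eraseIdx_of_lt hj
      rw [ih _ (by omega) (l.eraseIdx j) rfl, hlen, List.map_cons, List.prod_cons,
        ← prod_map_eraseIdx f l j, List.length_cons,
        show (l.length + 1) / 2 = (l.length - 1) / 2 + 1 by omega, pow_succ]
      ring

theorem pfaffian_map {S : Type*} [CommRing S] (θ : R →+* S) (M : ι → ι → R) :
    ∀ (n : ℕ) (l : List ι), l.length = n →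
      θ (pfaffian M l) = pfaffian (fun i j => θ (M i j)) l := by
  intro n
  induction n using Nat.strong_induction_on with
  | _ n ih =>
    rintro (_ | ⟨i, l⟩) hn
    · simp [pfaffian_nil]
    · rw [pfaffian_cons, pfaffian_cons, map_sum]
      refine sum_congr rfl fun j _ => ?_
      have hj := j.2
      rw [List.length_cons] at hn
      have hlen : (l.eraseIdx j).length = l.length - 1 := List.length_eraseIdx_of_lt hj
      rw [map_mul, map_mul, ih _ (by omega) (l.eraseIdx j) rfl]
      simp

theorem pfaffian_of_odd (M : ι → ι → R) :
    ∀ (n : ℕ) (l : List ι), l.length = n → Odd n → pfaffian M l = 0 := by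
  intro n
  induction n using Nat.strong_induction_on with
  | _ n ih =>
    rintro (_ | ⟨i, l⟩) hn hodd
    · subst hn; simp at hodd
    · rw [pfaffian_cons]
      refine sum_eq_zero fun j _ => ?_
      have hj := j.2
      rw [List.length_cons] at hn
      have hlen : (l.eraseIdx j).length = l.length - 1 := List.length_eraseIdx_of_lt hj
      rw [ih _ (by omega) (l.eraseIdx j) rfl (by rw [hlen]; rw [Nat.odd_iff] at *; omega)]
      simp

/-- Moving an operator through a product of operators with which it anticommutes up to central
elements. -/
theorem mul_prod_of_anticomm {E : Type*} [Ring E] (κ : R →+* E)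
    (hκ : ∀ r e, κ r * e = e * κ r) (M : ι → ι → R) (A N : ι → E)
    (hNA : ∀ i j, N i * A j + A j * N i = κ (M i j)) (i : ι) (l : List ι) :
    N i * (l.map A).prod =
      ∑ j : Fin l.length, (-1) ^ (j : ℕ) * (κ (M i (l.get j)) * ((l.eraseIdx j).map A).prod)
        + (-1) ^ l.length * ((l.map A).prod * N i) := by
  induction l with
  | nil => simp
  | cons a l ih =>
    rw [List.map_cons, List.prod_cons, ← mul_assoc, eq_sub_of_add_eq (hNA i a), sub_mul,
      mul_assoc (A a), ih, mul_add, mul_sum]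
    simp only [List.length_cons]
    rw [Fin.sum_univ_succ]
    have hs : ∀ (n : ℕ) (x : E), A a * ((-1) ^ n * x) = (-1) ^ n * (A a * x) := fun n x => by
      rw [← mul_assoc, ← mul_assoc, ((Commute.neg_one_right (A a)).pow_right n).eq]
    have hk : ∀ (r : R) (x : E), A a * (κ r * x) = κ r * (A a * x) := fun r x => by
      rw [← mul_assoc, ← mul_assoc, hκ]
    simp only [hs, hk, Fin.val_zero, pow_zero, one_mul, List.get_cons_zero, List.eraseIdx_cons_zero,
      Fin.val_succ, List.get_cons_succ', List.eraseIdx_cons_succ, List.map_cons, List.prod_cons,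
      pow_succ, mul_neg, mul_one, neg_mul, sum_neg_distrib, mul_assoc]
    abel

/-- Wick's theorem: the vacuum expectation value `v` of a product of operators is a Pfaffian. -/
theorem wick {E : Type*} [Ring E] (κ : R →+* E) (hκ : ∀ r e, κ r * e = e * κ r)
    (M : ι → ι → R) (A N : ι → E) (hNA : ∀ i j, N i * A j + A j * N i = κ (M i j))
    (v : E →+ R) (hv : ∀ r e, v (κ r * e) = r * v e) (hv1 : v 1 = 1)
    (hN : ∀ i e, v (e * N i) = 0) (hA : ∀ i e, v (A i * e) = v (N i * e)) :
    ∀ (n : ℕ) (l : List ι), l.length = n → v (l.map A).prod = pfaffian M l := by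
  intro n
  induction n using Nat.strong_induction_on with
  | _ n ih =>
    rintro (_ | ⟨i, l⟩) hn
    · simp [pfaffian_nil, hv1]
    · have hs : ∀ (n : ℕ) (x : E), v ((-1) ^ n * x) = (-1) ^ n * v x := fun n x => by
        have := hv ((-1) ^ n) x
        rwa [map_pow, map_neg, map_one] at this
      -- Under `v` the leading operator may be replaced by its annihilating part, which is then
      -- carried to the right end, where it gives zero. The contractions left behind are the row
      -- expansion of the Pfaffian.
      rw [List.map_cons, List.prod_cons, hA, mul_prod_of_anticomm κ hκ M A N hNA, map_add, hs, hN,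
        mul_zero, add_zero, map_sum, pfaffian_cons]
      refine sum_congr rfl fun j _ => ?_
      have hj := j.2
      rw [List.length_cons] at hn
      have hlen : (l.eraseIdx j).length = l.length - 1 := List.length_eraseIdx_of_lt hj
      rw [hs, hv, ih _ (by omega) (l.eraseIdx j) rfl]

end Pfaffian

/-! ### Coefficientwise vacuum expectation, scalar series and weights. -/

section VacuumExpectation

variable {K : Type*} [Field K]

/-- Coefficientwise vacuum expectation value. -/
def vevSeries (K : Type*) [Field K] :
    MvPowerSeries Times (Module.End K (Fock K)) →+ MvPowerSeries Times K where
  toFun P := fun d => vev K (MvPowerSeries.coeff d P)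
  map_zero' := by
    ext d
    exact map_zero (vev K)
  map_add' P P' := by
    ext d
    exact map_add (vev K) (MvPowerSeries.coeff d P) (MvPowerSeries.coeff d P')

theorem coeff_vevSeries (P : MvPowerSeries Times (Module.End K (Fock K))) (d : Times →₀ ℕ) :
    MvPowerSeries.coeff d (vevSeries K P) = vev K (MvPowerSeries.coeff d P) := rfl

theorem vev_apply (T : Module.End K (Fock K)) : vev K T = covacuum K (T (vacuum K)) := rfl

/-- Scalar series as series of scalar operators. -/
def scalarSeries (K : Type*) [Field K] :
    MvPowerSeries Times K →+* MvPowerSeries Times (Module.End K (Fock K)) :=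
  MvPowerSeries.map (algebraMap K (Module.End K (Fock K)))

theorem coeff_scalarSeries (g : MvPowerSeries Times K) (d : Times →₀ ℕ) :
    MvPowerSeries.coeff d (scalarSeries K g) =
      algebraMap K (Module.End K (Fock K)) (MvPowerSeries.coeff d g) :=
  MvPowerSeries.coeff_map ..

theorem scalarSeries_mul_comm (g : MvPowerSeries Times K)
    (P : MvPowerSeries Times (Module.End K (Fock K))) :
    scalarSeries K g * P = P * scalarSeries K g := by
  ext1 d
  rw [MvPowerSeries.coeff_mul, coeff_mul_swap]
  refine sum_congr rfl fun p _ => ?_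
  simp only [coeff_scalarSeries]
  exact Algebra.commutes _ _

theorem vevSeries_scalarSeries_mul (g : MvPowerSeries Times K)
    (P : MvPowerSeries Times (Module.End K (Fock K))) :
    vevSeries K (scalarSeries K g * P) = g * vevSeries K P := by
  ext d
  rw [coeff_vevSeries, MvPowerSeries.coeff_mul, MvPowerSeries.coeff_mul, map_sum]
  refine sum_congr rfl fun p _ => ?_
  rw [coeff_scalarSeries, coeff_vevSeries, ← Algebra.smul_def, map_smul, smul_eq_mul]

theorem vevSeries_one : vevSeries K 1 = 1 := by
  classical
  ext d
  rw [coeff_vevSeries, MvPowerSeries.coeff_one, MvPowerSeries.coeff_one]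
  split_ifs
  · exact vev_one
  · exact map_zero _

theorem vevSeries_mul_eq_zero (P N : MvPowerSeries Times (Module.End K (Fock K)))
    (hN : ∀ d, MvPowerSeries.coeff d N (vacuum K) = 0) : vevSeries K (P * N) = 0 := by
  ext d
  rw [coeff_vevSeries, MvPowerSeries.coeff_mul, map_sum]
  refine sum_eq_zero fun p _ => ?_
  rw [vev_apply, Module.End.mul_apply, hN, map_zero, map_zero]

theorem vevSeries_mul_eq_zero' (C P : MvPowerSeries Times (Module.End K (Fock K)))
    (hC : ∀ d v, covacuum K (MvPowerSeries.coeff d C v) = 0) : vevSeries K (C * P) = 0 := by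
  ext d
  rw [coeff_vevSeries, MvPowerSeries.coeff_mul, map_sum]
  refine sum_eq_zero fun p _ => ?_
  rw [vev_apply, Module.End.mul_apply, hC]

/-! ### Series linear in the times -/

theorem coeff_linearSeries_single {A : Type*} [Semiring A] {x : OddIdx → Times}
    (hx : Function.Injective x) (b : OddIdx → A) (k : OddIdx) :
    MvPowerSeries.coeff (Finsupp.single (x k) 1) (linearSeries x b) = b k := by
  classical
  change ∑ᶠ n, MvPowerSeries.coeff (Finsupp.single (x k) 1)
    (MvPowerSeries.monomial (Finsupp.single (x n) 1) (b n)) = _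
  rw [finsum_eq_single _ k]
  · simp
  · intro n hn
    rw [MvPowerSeries.coeff_monomial, if_neg]
    exact fun h => hn (hx (Finsupp.single_left_injective one_ne_zero h)).symm

theorem coeff_linearSeries_of_ne {A : Type*} [Semiring A] {x : OddIdx → Times}
    (b : OddIdx → A) {d : Times →₀ ℕ} (hd : ∀ k, d ≠ Finsupp.single (x k) 1) :
    MvPowerSeries.coeff d (linearSeries x b) = 0 := by
  classical
  change ∑ᶠ n, MvPowerSeries.coeff d
    (MvPowerSeries.monomial (Finsupp.single (x n) 1) (b n)) = _
  refine finsum_eq_zero_of_forall_eq_zero fun n => ?_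
  rw [MvPowerSeries.coeff_monomial, if_neg (hd n)]

theorem constantCoeff_linearSeries {A : Type*} [Semiring A] {x : OddIdx → Times}
    (b : OddIdx → A) : MvPowerSeries.constantCoeff (linearSeries x b) = 0 := by
  rw [← MvPowerSeries.coeff_zero_eq_constantCoeff_apply]
  refine coeff_linearSeries_of_ne b fun k h => ?_
  exact one_ne_zero (Finsupp.single_eq_zero.mp h.symm)

/-- The index `n` of the variables `t_n` and `t_n^*`. -/
def timeIndex : Times → ℕ := Sum.elim Subtype.val Subtype.val

/-- The degree in which the variables `t_n` and `t_n^*` have degree `n`. -/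
def wt : (Times →₀ ℕ) →+ ℕ := Finsupp.weight timeIndex

theorem wt_single (i : Times) : wt (Finsupp.single i 1) = timeIndex i := by
  simp [wt, Finsupp.weight_single]

end VacuumExpectation

/-! ### Time evolution of the fermions. -/

section Evolution

variable {K : Type*} [Field K] (rt : ℤ → K) (x : OddIdx → Times)

/-- The series `∑ x_k`. -/
def timeSum (K : Type*) [Field K] (x : OddIdx → Times) : MvPowerSeries Times K :=
  linearSeries x fun _ => 1

/-- The series of operators `∑_d g_d r̃(n) ⋯ r̃(n - |d| + 1) T(n - |d|) x^d`. -/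
def evolved (T : ℤ → Module.End K (Fock K)) (n : ℤ) :
    MvPowerSeries Times K →ₗ[K] MvPowerSeries Times (Module.End K (Fock K)) :=
  decorate fun d => fallingProd rt n (wt d) • T (n - wt d)

theorem coeff_evolved (T : ℤ → Module.End K (Fock K)) (n : ℤ) (g : MvPowerSeries Times K)
    (d : Times →₀ ℕ) : MvPowerSeries.coeff d (evolved rt T n g) =
      MvPowerSeries.coeff d g • fallingProd rt n (wt d) • T (n - wt d) := rfl

variable {rt x}

/-- Lowering the index by `wt p.2` and then by `k` concatenates the two falling products into a
single one, which depends only on the total weight. So the commutator with `B̃` is multiplication of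
the scalar part by `∑ x_k`. -/
theorem linearSeries_mul_evolved [CharZero K] (hrt : ∀ n, rt n = rt (1 - n))
    (hx : Function.Injective x) (hi : ∀ k, timeIndex (x k) = k.1) (n : ℤ)
    (g : MvPowerSeries Times K) :
    linearSeries x (Btilde rt) * evolved rt (phi K) n g =
      evolved rt (phi K) n (timeSum K x * g) +
        evolved rt (phi K) n g * linearSeries x (Btilde rt) := by
  classical
  ext1 d
  rw [map_add, MvPowerSeries.coeff_mul, coeff_mul_swap (evolved rt (phi K) n g), coeff_evolved,
    MvPowerSeries.coeff_mul, sum_smul, ← sum_add_distrib]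
  refine sum_congr rfl fun p hp => ?_
  rw [HasAntidiagonal.mem_antidiagonal] at hp
  simp only [coeff_evolved]
  by_cases h : ∃ k, p.1 = Finsupp.single (x k) 1
  · obtain ⟨k, hk⟩ := h
    have hwt : wt d = wt p.2 + k.1 := by
      rw [← hp, map_add, hk, wt_single, hi, add_comm]
    rw [hk, coeff_linearSeries_single hx, timeSum, coeff_linearSeries_single hx, hwt,
      fallingProd_add, one_mul]
    refine LinearMap.ext fun v => ?_
    simp only [Module.End.mul_apply, LinearMap.smul_apply, LinearMap.add_apply, map_smul,
      Btilde_phi_apply rt hrt]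
    rw [show n - ((wt p.2 + k.1 : ℕ) : ℤ) = n - wt p.2 - k.1 by push_cast; ring]
    module
  · push Not at h
    rw [coeff_linearSeries_of_ne _ h, timeSum, coeff_linearSeries_of_ne _ h]
    simp

theorem formalExp_mul_phi [CharZero K] (hrt : ∀ n, rt n = rt (1 - n))
    (hx : Function.Injective x) (hi : ∀ k, timeIndex (x k) = k.1) (n : ℤ) :
    formalExp K (linearSeries x (Btilde rt)) * MvPowerSeries.C (phi K n) =
      evolved rt (phi K) n (formalExp K (timeSum K x)) *
        formalExp K (linearSeries x (Btilde rt)) := by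
  classical
  have h := formalExp_mul_decorate (T := fun d => fallingProd rt n (wt d) • phi K (n - wt d))
    (constantCoeff_linearSeries (x := x) (Btilde rt)) (constantCoeff_linearSeries (x := x) _)
    (linearSeries_mul_evolved hrt hx hi n)
  refine Eq.trans ?_ h
  congr 1
  ext1 d
  change _ = MvPowerSeries.coeff d (1 : MvPowerSeries Times K) •
    fallingProd rt n (wt d) • phi K (n - wt d)
  rw [MvPowerSeries.coeff_C, MvPowerSeries.coeff_one]
  split_ifs with h
  · subst h
    simp [fallingProd]
  · rw [zero_smul]

theorem formalExp_mul_prod_phi [CharZero K] (hrt : ∀ n, rt n = rt (1 - n))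
    (hx : Function.Injective x) (hi : ∀ k, timeIndex (x k) = k.1) (l : List ℕ) :
    formalExp K (linearSeries x (Btilde rt)) *
        MvPowerSeries.C (l.map fun n : ℕ => phi K n).prod =
      (l.map fun n : ℕ => evolved rt (phi K) n (formalExp K (timeSum K x))).prod *
        formalExp K (linearSeries x (Btilde rt)) := by
  induction l with
  | nil => simp
  | cons n l ih =>
    rw [List.map_cons, List.prod_cons, map_mul, ← mul_assoc, formalExp_mul_phi hrt hx hi,
      mul_assoc, ih, List.map_cons, List.prod_cons, mul_assoc]

theorem coeff_linearSeries_Btilde_vacuum [CharZero K] (hx : Function.Injective x)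
    (d : Times →₀ ℕ) :
    MvPowerSeries.coeff d (linearSeries x (Btilde rt)) (vacuum K) = 0 := by
  by_cases h : ∃ k, d = Finsupp.single (x k) 1
  · obtain ⟨k, rfl⟩ := h
    rw [coeff_linearSeries_single hx, Btilde_vacuum]
  · push Not at h
    rw [coeff_linearSeries_of_ne _ h, LinearMap.zero_apply]

/-- If `X` annihilates the vacuum, then `e^X` fixes it. -/
theorem vevSeries_mul_formalExp {P X : MvPowerSeries Times (Module.End K (Fock K))}
    (hX0 : MvPowerSeries.constantCoeff X = 0)
    (hX : ∀ d, MvPowerSeries.coeff d X (vacuum K) = 0) :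
    vevSeries K (P * formalExp K X) = vevSeries K P := by
  ext d
  have hzero : ∀ N : ℕ, vev K (MvPowerSeries.coeff d (P * X ^ N * X)) = 0 := fun N => by
    rw [← coeff_vevSeries, vevSeries_mul_eq_zero _ _ hX, map_zero]
  have h := coeff_mul_formalExp (K := K) (A := Module.End K (Fock K)) (P := P) (X := X)
    (by exact hX0) d
  refine (congrArg (vev K) h).trans ?_
  rw [map_add, map_sum, coeff_vevSeries, sum_eq_zero, add_zero]
  intro N _
  rw [map_smul, hzero, smul_zero]

end Evolution

/-! ### The two-point function and Schur's two-row `Q`-functions. -/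

section TwoPoint

variable {K : Type*} [Field K] {rt : ℤ → K} {x : OddIdx → Times}

/-- The first product overshoots `r(1)` by the factors `r(0)⋯r(1-n)`, which by symmetry are
`r(1)⋯r(n)`, exactly those missing from the second. Independence of `n` is what lets the content
factor out of the `Q`-function. -/
theorem fallingProd_mul_fallingProd (hrt : ∀ n, rt n = rt (1 - n)) (a b n : ℕ) (hn : n ≤ b) :
    fallingProd rt a (a + n) * fallingProd rt b (b - n) =
      fallingProd rt a a * fallingProd rt b b := by
  have h1 : fallingProd rt ((a : ℤ) - a) n = fallingProd rt (n : ℤ) n := by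
    rw [fallingProd_natCast, fallingProd, ← Ico_add_one_right_eq_Icc, prod_Ico_eq_prod_range]
    refine prod_congr rfl fun i _ => ?_
    rw [hrt]
    congr 1
    push_cast
    ring
  have h2 : fallingProd rt b b = fallingProd rt b (b - n) * fallingProd rt (n : ℤ) n := by
    conv_lhs => rw [show b = (b - n) + n by omega]
    rw [fallingProd_add]
    congr 2
    · push_cast; omega
    · push_cast [hn]; ring
  rw [fallingProd_add, h1, h2]
  ring

/-- The two-point function is nonzero only at indices `(-n, n)` with `n ≥ 0`, that is `s = a + n`,
`t = b - n`. Its values `1/2` and `(-1)^n` are half the coefficients in `Q₂`. -/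
theorem fallingProd_mul_twoPoint [CharZero K] (hrt : ∀ n, rt n = rt (1 - n)) (a b s t : ℕ) :
    fallingProd rt a s * fallingProd rt b t * twoPoint K (a - s) (b - t) =
      2⁻¹ * (fallingProd rt a a * fallingProd rt b b) *
        ((if s = a ∧ t = b then 1 else 0) +
          2 * ∑ i ∈ Icc 1 b, (-1) ^ i * (if s = a + i ∧ t = b - i then 1 else 0)) := by
  by_cases h : ∃ n ≤ b, s = a + n ∧ t = b - n
  · obtain ⟨n, hn, rfl, rfl⟩ := h
    rw [fallingProd_mul_fallingProd hrt a b n hn]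
    rcases Nat.eq_zero_or_pos n with rfl | hpos
    · rw [sum_eq_zero]
      · simp [twoPoint]; ring
      · intro i hi
        rw [mem_Icc] at hi
        rw [if_neg (by omega), mul_zero]
    · rw [sum_eq_single n]
      · rw [twoPoint, if_pos (by push_cast [hn]; ring), if_neg (by push_cast [hn]; omega),
          if_pos (by push_cast [hn]; omega), if_neg (by omega), if_pos ⟨rfl, rfl⟩,
          show (b : ℤ) - ((b - n : ℕ) : ℤ) = n by push_cast [hn]; ring, zpow_natCast]
        field_simp
        ring
      · intro i hi hin
        rw [if_neg (by omega), mul_zero]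
      · intro hi
        rw [mem_Icc] at hi
        omega
  · have hz : twoPoint K (a - s) (b - t) = 0 := by
      rw [twoPoint]
      split_ifs with h1 h2 h3
      · exact absurd ⟨0, by omega, by omega, by omega⟩ h
      · exact absurd ⟨b - t, by omega, by omega, by omega⟩ h
      · rfl
      · rfl
    rw [hz, mul_zero, if_neg, sum_eq_zero]
    · simp
    · intro i hi
      rw [mem_Icc] at hi
      rw [if_neg, mul_zero]
      exact fun h' => h ⟨i, hi.2, h'.1, h'.2⟩
    · exact fun h' => h ⟨0, by omega, by omega, by omega⟩

/-- The two-point function of evolved fermions. -/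
def twoPointSeries (rt : ℤ → K) (x : OddIdx → Times) (a b : ℤ) : MvPowerSeries Times K := fun d =>
  ∑ p ∈ antidiagonal d, MvPowerSeries.coeff p.1 (formalExp K (timeSum K x)) *
    MvPowerSeries.coeff p.2 (formalExp K (timeSum K x)) *
    (fallingProd rt a (wt p.1) * fallingProd rt b (wt p.2) *
      twoPoint K (a - wt p.1) (b - wt p.2))

/-- Evolution is linear in the fermions, so the anticommutator stays central and Wick's theorem
still applies. -/
theorem evolved_annihilation_anticomm [CharZero K] (a b : ℤ) :
    evolved rt annihilation a (formalExp K (timeSum K x)) *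
          evolved rt (phi K) b (formalExp K (timeSum K x)) +
        evolved rt (phi K) b (formalExp K (timeSum K x)) *
          evolved rt annihilation a (formalExp K (timeSum K x)) =
      scalarSeries K (twoPointSeries rt x a b) := by
  ext1 d
  rw [map_add, MvPowerSeries.coeff_mul, coeff_mul_swap, ← sum_add_distrib, coeff_scalarSeries]
  change _ = algebraMap K (Module.End K (Fock K)) (∑ p ∈ antidiagonal d, _)
  rw [map_sum]
  refine sum_congr rfl fun p _ => ?_
  have h := annihilation_anticomm (K := K) (a - wt p.1) (b - wt p.2)
  rw [map_mul, map_mul (algebraMap K (Module.End K (Fock K))) (_ * _) (twoPoint K _ _), ← h]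
  simp only [coeff_evolved]
  refine LinearMap.ext fun v => ?_
  simp only [LinearMap.add_apply, Module.End.mul_apply, LinearMap.smul_apply, map_smul,
    Module.algebraMap_end_apply, map_mul]
  module

theorem evolved_creation_add_annihilation (n : ℤ) (g : MvPowerSeries Times K) :
    evolved rt (phi K) n g = evolved rt creation n g + evolved rt annihilation n g := by
  ext1 d
  rw [map_add]
  simp only [coeff_evolved, ← creation_add_annihilation (K := K) (n - wt d), smul_add]

theorem vevSeries_formalExp_mul_prod_phi [CharZero K] (hrt : ∀ n, rt n = rt (1 - n))
    (hx : Function.Injective x) (hi : ∀ k, timeIndex (x k) = k.1) (l : List ℕ) :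
    vevSeries K (formalExp K (linearSeries x (Btilde rt)) *
        MvPowerSeries.C (l.map fun n : ℕ => phi K n).prod) =
      pfaffian (fun a b : ℕ => twoPointSeries rt x a b) l := by
  rw [formalExp_mul_prod_phi hrt hx hi, vevSeries_mul_formalExp (constantCoeff_linearSeries _)
    (coeff_linearSeries_Btilde_vacuum hx)]
  refine wick (scalarSeries K) scalarSeries_mul_comm (fun a b : ℕ => twoPointSeries rt x a b)
    (fun n : ℕ => evolved rt (phi K) n (formalExp K (timeSum K x)))
    (fun n : ℕ => evolved rt annihilation n (formalExp K (timeSum K x)))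
    (fun a b => evolved_annihilation_anticomm _ _) (vevSeries K) vevSeries_scalarSeries_mul
    vevSeries_one (fun i e => ?_) (fun i e => ?_) _ l rfl
  · refine vevSeries_mul_eq_zero _ _ fun d => ?_
    rw [coeff_evolved, LinearMap.smul_apply, LinearMap.smul_apply, annihilation_vacuum, smul_zero,
      smul_zero]
  · rw [evolved_creation_add_annihilation, add_mul, map_add, vevSeries_mul_eq_zero' _ _, zero_add]
    intro d v
    rw [coeff_evolved, LinearMap.smul_apply, LinearMap.smul_apply, map_smul, map_smul,
      covacuum_creation, smul_zero, smul_zero]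

/-- The substitution `s = t / 2`. -/
def halfSubst (K : Type*) [Field K] (x : OddIdx → Times) :
    MvPolynomial OddIdx K →ₐ[K] MvPowerSeries Times K :=
  MvPolynomial.aeval fun n => (2⁻¹ : K) • MvPowerSeries.X (x n)

/-- The exponent `2 ∑ s_m z^m` of the generating function of the `q_n`. -/
def qExponent (K : Type*) [Field K] : PowerSeries (MvPolynomial OddIdx K) :=
  PowerSeries.mk fun m => if h : Odd m then 2 * MvPolynomial.X ⟨m, h⟩ else 0

theorem ite_zero_sum {ι M : Type*} [AddCommMonoid M] (P : Prop) [Decidable P] (s : Finset ι)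
    (f : ι → M) : ∑ i ∈ s, (if P then f i else 0) = if P then ∑ i ∈ s, f i else 0 := by
  split_ifs <;> simp

theorem coeff_halfSubst_qExponent [CharZero K] (hx : Function.Injective x)
    (hi : ∀ k, timeIndex (x k) = k.1) (j : ℕ) (d : Times →₀ ℕ) :
    MvPowerSeries.coeff d (halfSubst K x (PowerSeries.coeff j (qExponent K))) =
      if wt d = j then MvPowerSeries.coeff d (timeSum K x) else 0 := by
  classical
  have hX : halfSubst K x (PowerSeries.coeff j (qExponent K)) =
      if h : Odd j then MvPowerSeries.X (x ⟨j, h⟩) else 0 := by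
    rw [qExponent, PowerSeries.coeff_mk]
    split_ifs with h
    · rw [map_mul, map_ofNat, halfSubst, MvPolynomial.aeval_X, mul_smul_comm,
        show (2 : MvPowerSeries Times K) * MvPowerSeries.X (x ⟨j, h⟩) =
          (2 : K) • MvPowerSeries.X (x ⟨j, h⟩) by rw [two_smul, two_mul], smul_smul]
      simp
    · rw [map_zero]
  rw [hX]
  by_cases hd : ∃ k, d = Finsupp.single (x k) 1
  · obtain ⟨k, rfl⟩ := hd
    rw [wt_single, hi, timeSum, coeff_linearSeries_single hx]
    by_cases hj : k.1 = j
    · subst hj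
      simp [k.2, MvPowerSeries.coeff_X]
    · rw [if_neg hj]
      split_ifs with h
      · rw [MvPowerSeries.coeff_X, if_neg]
        intro h'
        exact hj (congrArg Subtype.val (hx (Finsupp.single_left_injective one_ne_zero h')))
      · rw [map_zero]
  · push Not at hd
    rw [timeSum, coeff_linearSeries_of_ne _ hd, ite_self]
    split_ifs with h
    · rw [MvPowerSeries.coeff_X, if_neg (hd _)]
    · rw [map_zero]

theorem coeff_halfSubst_qExponent_pow [CharZero K] (hx : Function.Injective x)
    (hi : ∀ k, timeIndex (x k) = k.1) (N j : ℕ) (d : Times →₀ ℕ) :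
    MvPowerSeries.coeff d (halfSubst K x (PowerSeries.coeff j (qExponent K ^ N))) =
      if wt d = j then MvPowerSeries.coeff d (timeSum K x ^ N) else 0 := by
  classical
  induction N generalizing j d with
  | zero =>
    rw [pow_zero, pow_zero, PowerSeries.coeff_one, MvPowerSeries.coeff_one]
    by_cases hd : d = 0
    · subst hd
      rw [map_zero]
      by_cases hj : j = 0
      · subst hj; simp
      · rw [if_neg hj, map_zero, map_zero, if_neg (Ne.symm hj)]
    · rw [if_neg hd, ite_self]
      split_ifs
      · rw [map_one, MvPowerSeries.coeff_one, if_neg hd]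
      · rw [map_zero, map_zero]
  | succ N ih =>
    rw [pow_succ, pow_succ, PowerSeries.coeff_mul, map_sum, map_sum, MvPowerSeries.coeff_mul]
    simp only [map_mul, MvPowerSeries.coeff_mul, ih, coeff_halfSubst_qExponent hx hi]
    rw [sum_comm, ← ite_zero_sum]
    refine sum_congr rfl fun p hp => ?_
    rw [HasAntidiagonal.mem_antidiagonal] at hp
    have hwt : wt d = wt p.1 + wt p.2 := by rw [← hp, map_add]
    split_ifs with h
    · rw [sum_eq_single (wt p.1, wt p.2)]
      · rw [if_pos rfl, if_pos rfl]
      · intro e _ hne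
        by_cases h1 : wt p.1 = e.1
        · by_cases h2 : wt p.2 = e.2
          · exact absurd (Prod.ext h1.symm h2.symm) hne
          · rw [if_neg h2, mul_zero]
        · rw [if_neg h1, zero_mul]
      · intro h'
        exact absurd (HasAntidiagonal.mem_antidiagonal.mpr (hwt.symm.trans h)) h'
    · refine sum_eq_zero fun e he => ?_
      rw [HasAntidiagonal.mem_antidiagonal] at he
      by_cases h1 : wt p.1 = e.1
      · rw [if_neg (fun h2 : wt p.2 = e.2 => h (by omega)), mul_zero]
      · rw [if_neg h1, zero_mul]

/-- After `s = t/2` the exponent `2 ∑ s_m z^m` becomes `∑ t_m z^m`, in which `z` records the weight.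
Thus `q_j(t/2)` is the part of weight `j` of `exp(∑ t_m)`. -/
theorem coeff_halfSubst_q [CharZero K] (hx : Function.Injective x)
    (hi : ∀ k, timeIndex (x k) = k.1) (j : ℕ) (d : Times →₀ ℕ) :
    MvPowerSeries.coeff d (halfSubst K x (q K j)) =
      if wt d = j then MvPowerSeries.coeff d (formalExp K (timeSum K x)) else 0 := by
  have hT : MvPowerSeries.constantCoeff (qExponent K) = 0 := by
    change PowerSeries.constantCoeff (qExponent K) = 0
    rw [← PowerSeries.coeff_zero_eq_constantCoeff_apply, qExponent, PowerSeries.coeff_mk,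
      dif_neg (by decide)]
  -- One truncation order that serves both exponentials: order `j` in `z`, and degree of `d` in the
  -- times.
  set m := max j d.degree + 1 with hm
  have hj : (Finsupp.single () j : Unit →₀ ℕ).degree < m := by
    rw [Finsupp.degree_single]; omega
  have hq : q K j = PowerSeries.coeff j (truncExp K m (qExponent K)) :=
    coeff_formalExp hT hj
  have hL : MvPowerSeries.coeff d (formalExp K (timeSum K x)) =
      MvPowerSeries.coeff d (truncExp K m (timeSum K x)) :=
    coeff_formalExp (constantCoeff_linearSeries _) (show d.degree < m by omega)
  rw [hq, hL, truncExp, truncExp, map_sum, map_sum, map_sum, map_sum, ← ite_zero_sum]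
  refine sum_congr rfl fun N _ => ?_
  have hs : PowerSeries.coeff j ((N.factorial : K)⁻¹ • qExponent K ^ N) =
      (N.factorial : K)⁻¹ • PowerSeries.coeff j (qExponent K ^ N) := rfl
  rw [hs, map_smul, coeff_smul_field, coeff_smul_field, coeff_halfSubst_qExponent_pow hx hi]
  split_ifs <;> simp

/-- Splitting `d` into two exponents of weights `s` and `t` selects `q_s` and `q_t`, and
`fallingProd_mul_twoPoint` weights these pairs as in `Q₂`. -/
theorem twoPointSeries_eq [CharZero K] (hrt : ∀ n, rt n = rt (1 - n))
    (hx : Function.Injective x) (hi : ∀ k, timeIndex (x k) = k.1) (a b : ℕ) :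
    twoPointSeries rt x a b = MvPowerSeries.C (2⁻¹ : K) *
        (MvPowerSeries.C (fallingProd rt a a) * MvPowerSeries.C (fallingProd rt b b)) *
      halfSubst K x (Q₂ K a b) := by
  ext d
  have hc : ∀ i : ℕ, ((-1) ^ i : MvPowerSeries Times K) = MvPowerSeries.C ((-1) ^ i) := by
    intro i
    rw [map_pow, map_neg, map_one]
  have h2 : (2 : MvPowerSeries Times K) = MvPowerSeries.C 2 := (map_ofNat _ 2).symm
  rw [← map_mul, ← map_mul, MvPowerSeries.coeff_C_mul, Q₂, map_add, map_mul, map_mul, map_sum,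
    map_ofNat, h2, map_add, MvPowerSeries.coeff_C_mul, map_sum]
  simp only [map_mul (halfSubst K x), map_pow (halfSubst K x), map_neg (halfSubst K x),
    map_one (halfSubst K x), hc, MvPowerSeries.coeff_C_mul]
  simp only [MvPowerSeries.coeff_mul, coeff_halfSubst_q hx hi, mul_sum]
  rw [sum_comm, ← sum_add_distrib, mul_sum]
  change ∑ p ∈ antidiagonal d, _ = _
  refine sum_congr rfl fun p _ => ?_
  rw [fallingProd_mul_twoPoint hrt, mul_sum, mul_add, mul_add, mul_add, mul_sum, mul_sum, mul_sum]
  congr 1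
  · split_ifs <;> first | (exfalso; omega) | ring
  · refine sum_congr rfl fun i _ => ?_
    split_ifs <;> first | (exfalso; omega) | ring

theorem vevSeries_formalExp_eq_pfaffian [CharZero K] (hrt : ∀ n, rt n = rt (1 - n))
    (hx : Function.Injective x) (hi : ∀ k, timeIndex (x k) = k.1) (l : List ℕ) :
    vevSeries K (formalExp K (linearSeries x (Btilde rt)) *
        MvPowerSeries.C (l.map fun n : ℕ => phi K n).prod) =
      MvPowerSeries.C ((2⁻¹ : K) ^ (l.length / 2) *
        (l.map fun n : ℕ => ∏ j ∈ Icc 1 n, rt (j : ℤ)).prod) *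
      halfSubst K x (pfaffian (Q₂ K) l) := by
  rw [vevSeries_formalExp_mul_prod_phi hrt hx hi]
  simp only [twoPointSeries_eq hrt hx hi]
  rw [pfaffian_smul (fun a b : ℕ => halfSubst K x (Q₂ K a b)) _
    (fun n : ℕ => MvPowerSeries.C (fallingProd rt n n)) _ l rfl, map_mul, map_pow, map_list_prod,
    List.map_map]
  congr 1
  · congr 3
    funext n
    simp only [Function.comp_apply, fallingProd_natCast]
  · exact (pfaffian_map (halfSubst K x).toRingHom (Q₂ K) _ l rfl).symm

end TwoPoint

/-! ### The invariant form and the adjointness of `-B` and `B̃`. -/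

section Adjoint

variable {K : Type*} [Field K]

/-- The square norm of the basis vector of `S`. -/
def normSq (K : Type*) [Field K] (S : Finset ℕ) : K := if 0 ∈ S then 2⁻¹ else 1

/-- The bilinear form on the Fock space with orthogonal basis vectors, with respect to which
`φ_n` is adjoint to `(-1)^n φ_{-n}`. -/
def pairing (K : Type*) [Field K] : Fock K →ₗ[K] Fock K →ₗ[K] K :=
  Finsupp.linearCombination K fun S => normSq K S • Finsupp.lapply S

theorem pairing_single (S : Finset ℕ) (u : Fock K) :
    pairing K (Finsupp.single S 1) u = normSq K S * u S := by
  simp [pairing]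

theorem pairing_single_right (v : Fock K) (S : Finset ℕ) :
    pairing K v (Finsupp.single S 1) = normSq K S * v S := by
  induction v using Finsupp.induction_linear with
  | zero => simp
  | add f g hf hg => rw [map_add, LinearMap.add_apply, hf, hg, Finsupp.add_apply, mul_add]
  | single S' c =>
    rw [single_eq_smul, map_smul, LinearMap.smul_apply, pairing_single, Finsupp.smul_apply,
      smul_eq_mul, smul_eq_mul, Finsupp.single_apply, Finsupp.single_apply]
    by_cases h : S = S'
    · subst h; simp; ring
    · simp [h, Ne.symm h]

theorem pairing_comm (v u : Fock K) : pairing K v u = pairing K u v := by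
  induction v using Finsupp.induction_linear with
  | zero => simp
  | add f g hf hg => rw [map_add, LinearMap.add_apply, hf, hg, map_add]
  | single S c =>
    rw [single_eq_smul, map_smul, LinearMap.smul_apply, pairing_single, map_smul,
      pairing_single_right]

/-- `T'` is the adjoint of `T` with respect to `pairing`. -/
def IsAdjoint (T T' : Module.End K (Fock K)) : Prop :=
  ∀ v u, pairing K (T v) u = pairing K v (T' u)

theorem IsAdjoint.of_single {T T' : Module.End K (Fock K)}
    (h : ∀ S S', pairing K (T (Finsupp.single S 1)) (Finsupp.single S' 1) =
      pairing K (Finsupp.single S 1) (T' (Finsupp.single S' 1))) : IsAdjoint T T' := by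
  intro v u
  induction v using Finsupp.induction_linear with
  | zero => simp
  | add f g hf hg => simp only [map_add, LinearMap.add_apply, hf, hg]
  | single S c =>
    rw [single_eq_smul, map_smul, map_smul, map_smul, LinearMap.smul_apply, LinearMap.smul_apply]
    congr 1
    induction u using Finsupp.induction_linear with
    | zero => simp
    | add f g hf hg => simp only [map_add, hf, hg]
    | single S' c' =>
      rw [single_eq_smul S' c', map_smul, map_smul, map_smul, h]

theorem IsAdjoint.symm {T T' : Module.End K (Fock K)} (h : IsAdjoint T T') : IsAdjoint T' T :=
  fun v u => by rw [pairing_comm, ← h, pairing_comm]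

theorem IsAdjoint.add {T T' U U' : Module.End K (Fock K)} (h : IsAdjoint T T')
    (h' : IsAdjoint U U') : IsAdjoint (T + U) (T' + U') := fun v u => by
  simp only [LinearMap.add_apply, map_add, h v u, h' v u]

theorem IsAdjoint.smul {T T' : Module.End K (Fock K)} (h : IsAdjoint T T') (c : K) :
    IsAdjoint (c • T) (c • T') := fun v u => by
  simp only [LinearMap.smul_apply, map_smul, h v u]

theorem IsAdjoint.mul {T T' U U' : Module.End K (Fock K)} (h : IsAdjoint T T')
    (h' : IsAdjoint U U') : IsAdjoint (T * U) (U' * T') := fun v u => by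
  rw [Module.End.mul_apply, Module.End.mul_apply, h, h']

theorem IsAdjoint.zero : IsAdjoint (0 : Module.End K (Fock K)) 0 := fun v u => by simp

theorem IsAdjoint.one : IsAdjoint (1 : Module.End K (Fock K)) 1 := fun v u => by simp

theorem IsAdjoint.sum {ι : Type*} (s : Finset ι) {T T' : ι → Module.End K (Fock K)}
    (h : ∀ i, IsAdjoint (T i) (T' i)) : IsAdjoint (∑ i ∈ s, T i) (∑ i ∈ s, T' i) := fun v u => by
  simp only [LinearMap.sum_apply, map_sum, h _ v u]

theorem isAdjoint_create (a : ℕ) :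
    IsAdjoint (create K a) ((if a = 0 then (2⁻¹ : K) else 1) • annihilate K a) := by
  refine IsAdjoint.of_single fun S S' => ?_
  rw [pairing_single_right, pairing_single, create_single, LinearMap.smul_apply,
    annihilate_single]
  by_cases h : a ∉ S ∧ insert a S = S'
  · obtain ⟨ha, rfl⟩ := h
    rw [if_neg ha, if_pos (mem_insert_self a S), erase_insert ha, Finsupp.smul_apply,
      Finsupp.single_eq_same, Finsupp.single_eq_same, fermiSign_insert ha, normSq, normSq]
    rcases Nat.eq_zero_or_pos a with rfl | hpos
    · simp [ha]
    · simp [hpos.ne, hpos.ne']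
  · have h1 : (if a ∈ S then (0 : Fock K) else
        Finsupp.single (insert a S) (fermiSign K a S)) S' = 0 := by
      by_cases ha : a ∈ S
      · rw [if_pos ha, Finsupp.zero_apply]
      · rw [if_neg ha, Finsupp.single_apply, if_neg fun h' => h ⟨ha, h'⟩]
    have h2 : (if a ∈ S' then Finsupp.single (S'.erase a) (fermiSign K a S') else
        (0 : Fock K)) S = 0 := by
      by_cases ha : a ∈ S'
      · rw [if_pos ha, Finsupp.single_apply, if_neg]
        rintro rfl
        exact h ⟨notMem_erase a S', insert_erase ha⟩
      · rw [if_neg ha, Finsupp.zero_apply]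
    rw [h1, Finsupp.smul_apply, h2]
    simp

/-- The norm `1/2` of vectors containing the zero mode makes `create K 0` adjoint to `2⁻¹ •
annihilate K 0`; the two halves of `φ_0` are exchanged and `φ_0` is self-adjoint. -/
theorem isAdjoint_phi (n : ℤ) : IsAdjoint (phi K n) ((-1 : K) ^ n • phi K (-n)) := by
  have hpos : ∀ m : ℤ, 0 < m → IsAdjoint (phi K m) ((-1 : K) ^ m • phi K (-m)) := fun m hm => by
    have := isAdjoint_create (K := K) m.natAbs
    rw [if_neg (by omega), one_smul] at this
    rw [phi_of_pos hm, phi_of_neg (by omega), smul_smul, neg_one_zpow_neg,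
      neg_one_zpow_mul_self, one_smul, Int.natAbs_neg]
    exact this
  rcases lt_trichotomy n 0 with h | rfl | h
  · have := ((hpos (-n) (by omega)).symm).smul ((-1 : K) ^ n)
    rwa [neg_one_zpow_neg, smul_smul, neg_one_zpow_mul_self, one_smul, neg_neg] at this
  · have := isAdjoint_create (K := K) 0
    rw [if_pos rfl] at this
    rw [zpow_zero, one_smul, neg_zero, phi_zero]
    nth_rewrite 2 [add_comm]
    exact this.add this.symm
  · exact hpos n h

theorem isAdjoint_bilinear [CharZero K] (c : ℤ → K) {k : ℤ} (hk : k ≠ 0) :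
    IsAdjoint (bilinear K c k) (bilinear K (fun m => (-1) ^ k * c (m + k)) (-k)) := by
  intro v u
  have hk' : -k ≠ 0 := by omega
  rw [bilinear_apply _ hk, bilinear_apply _ hk', map_finsum _ (finite_support_bilinear c hk v),
    map_finsum _ (finite_support_bilinear _ hk' u)]
  have hL : ((fun f : Fock K →ₗ[K] K => f u) (∑ᶠ n : ℤ,
      pairing K (c n • phi K n (phi K (k - n) v)))) =
      ∑ᶠ n : ℤ, pairing K (c n • phi K n (phi K (k - n) v)) u := by
    refine map_finsum (LinearMap.applyₗ u) ?_
    refine (finite_support_bilinear c hk v).subset fun n hn h => hn ?_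
    exact (congrArg (pairing K) h).trans (map_zero _)
  refine hL.trans ?_
  -- Taking adjoints turns `φ_n φ_{k-n}` into a multiple of `φ_{n-k} φ_{-n}`; the shift `n = m + k`
  -- restores the standard form `φ_m φ_{-k-m}`.
  rw [← finsum_comp_equiv (Equiv.addRight k)]
  refine finsum_congr fun m => ?_
  have h := ((isAdjoint_phi (K := K) (m + k)).mul (isAdjoint_phi (K := K) (k - (m + k)))).smul
    (c (m + k)) v u
  simp only [LinearMap.smul_apply, Module.End.mul_apply] at h
  change pairing K (c (m + k) • phi K (m + k) (phi K (k - (m + k)) v)) u = _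
  rw [h, map_smul (phi K (-(k - (m + k)))), show -(k - (m + k)) = m by ring,
    show -(m + k) = -k - m by ring, show k - (m + k) = -m by ring, neg_one_zpow_neg,
    zpow_add₀ (by norm_num), smul_smul, smul_smul]
  congr 2
  have := neg_one_zpow_mul_self (K := K) m
  linear_combination (c (m + k) * (-1) ^ k) * this

theorem isAdjoint_neg_B [CharZero K] (r : ℤ → K) (k : OddIdx) :
    IsAdjoint (-B r k) (Btilde r k) := by
  obtain ⟨k, hk⟩ := k
  have hk0 : (k : ℤ) ≠ 0 := by
    have := hk.pos
    omega
  have h := (isAdjoint_bilinear (K := K)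
    (fun n => 2⁻¹ * ((-1) ^ n * ∏ i ∈ range k, r (n - i))) hk0).smul (-1)
  intro v u
  have hB : (-B r ⟨k, hk⟩) v = ((-1 : K) • B r ⟨k, hk⟩) v := by
    rw [LinearMap.neg_apply, LinearMap.smul_apply, neg_one_smul]
  rw [hB]
  refine (h v u).trans ?_
  congr 1
  rw [LinearMap.smul_apply, Btilde, bilinear_apply _ (neg_ne_zero.mpr hk0),
    bilinear_apply _ (neg_ne_zero.mpr hk0), smul_finsum' _
      (finite_support_bilinear _ (neg_ne_zero.mpr hk0) u)]
  refine finsum_congr fun m => ?_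
  rw [smul_smul]
  congr 1
  have hp : ∏ i ∈ range k, r (m + k - i) = ∏ i ∈ range k, r (m + (i + 1)) := by
    rw [← prod_range_reflect]
    refine prod_congr rfl fun j hj => ?_
    rw [mem_range] at hj
    congr 1
    push_cast [show j ≤ k - 1 by omega, show 1 ≤ k by omega]
    ring
  rw [hp, zpow_add₀ (by norm_num), zpow_add₀ (by norm_num), zpow_natCast, hk.neg_one_pow]
  ring

/-- Coefficientwise adjointness. -/
def IsSeriesAdjoint (P P' : MvPowerSeries Times (Module.End K (Fock K))) : Prop :=
  ∀ d, IsAdjoint (MvPowerSeries.coeff d P) (MvPowerSeries.coeff d P')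

theorem IsSeriesAdjoint.mul {P P' Q Q' : MvPowerSeries Times (Module.End K (Fock K))}
    (h : IsSeriesAdjoint P P') (h' : IsSeriesAdjoint Q Q') :
    IsSeriesAdjoint (P * Q) (Q' * P') := fun d => by
  rw [MvPowerSeries.coeff_mul, coeff_mul_swap]
  exact IsAdjoint.sum _ fun p => (h p.1).mul (h' p.2)

theorem IsSeriesAdjoint.pow {P P' : MvPowerSeries Times (Module.End K (Fock K))}
    (h : IsSeriesAdjoint P P') (N : ℕ) : IsSeriesAdjoint (P ^ N) (P' ^ N) := by
  induction N with
  | zero =>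
    intro d
    rw [pow_zero, pow_zero, MvPowerSeries.coeff_one]
    split_ifs
    · exact IsAdjoint.one
    · exact IsAdjoint.zero
  | succ N ih =>
    rw [pow_succ, pow_succ']
    exact ih.mul h

theorem IsSeriesAdjoint.formalExp {P P' : MvPowerSeries Times (Module.End K (Fock K))}
    (h : IsSeriesAdjoint P P') (hP : MvPowerSeries.constantCoeff P = 0)
    (hP' : MvPowerSeries.constantCoeff P' = 0) :
    IsSeriesAdjoint (formalExp K P) (formalExp K P') := fun d => by
  have e := coeff_formalExp (K := K) (A := Module.End K (Fock K)) (X := P) (by exact hP)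
    (Nat.lt_succ_self d.degree)
  have e' := coeff_formalExp (K := K) (A := Module.End K (Fock K)) (X := P') (by exact hP')
    (Nat.lt_succ_self d.degree)
  have hs : IsAdjoint (MvPowerSeries.coeff d (truncExp K d.degree.succ P))
      (MvPowerSeries.coeff d (truncExp K d.degree.succ P')) := by
    rw [truncExp, truncExp, map_sum, map_sum]
    exact IsAdjoint.sum _ fun N => (h.pow N d).smul _
  intro v u
  have e1 := LinearMap.congr_fun e v
  have e2 := LinearMap.congr_fun e' u
  exact ((congrArg (fun z => pairing K z u) e1).trans (hs v u)).trans
    (congrArg (pairing K v) e2).symm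

theorem isSeriesAdjoint_linearSeries [CharZero K] (r : ℤ → K) {x : OddIdx → Times}
    (hx : Function.Injective x) :
    IsSeriesAdjoint (-linearSeries x (B r)) (linearSeries x (Btilde r)) := fun d => by
  rw [map_neg]
  by_cases h : ∃ k, d = Finsupp.single (x k) 1
  · obtain ⟨k, rfl⟩ := h
    rw [coeff_linearSeries_single hx, coeff_linearSeries_single hx]
    exact isAdjoint_neg_B r k
  · push Not at h
    rw [coeff_linearSeries_of_ne _ h, coeff_linearSeries_of_ne _ h]
    exact fun v u => by simp

theorem constantCoeff_neg_linearSeries {x : OddIdx → Times} (b : OddIdx → Module.End K (Fock K)) :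
    MvPowerSeries.constantCoeff (-linearSeries x b) = 0 := by
  rw [map_neg, constantCoeff_linearSeries]
  exact neg_zero (G := Module.End K (Fock K))

/-- The coefficients of `⟨0| e^{B̃} |S⟩`. -/
def amplitude (rt : ℤ → K) (x : OddIdx → Times) (S : Finset ℕ) : MvPowerSeries Times K := fun d =>
  covacuum K (MvPowerSeries.coeff d (formalExp K (linearSeries x (Btilde rt)))
    (Finsupp.single S 1))

theorem amplitude_toFinset [CharZero K] {rt : ℤ → K} (hrt : ∀ n, rt n = rt (1 - n))
    {x : OddIdx → Times} (hx : Function.Injective x) (hi : ∀ k, timeIndex (x k) = k.1)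
    (l : List ℕ) (hl : l.Pairwise (· > ·)) :
    amplitude rt x l.toFinset = MvPowerSeries.C ((2⁻¹ : K) ^ (l.length / 2) *
        (l.map fun n : ℕ => ∏ j ∈ Icc 1 n, rt (j : ℤ)).prod) *
      halfSubst K x (pfaffian (Q₂ K) l) := by
  rw [← vevSeries_formalExp_eq_pfaffian hrt hx hi l]
  ext d
  rw [coeff_vevSeries, MvPowerSeries.coeff_mul_C, vev_apply, Module.End.mul_apply,
    prod_phi_vacuum l hl]
  rfl

/-- Pairing with a basis vector extracts a component up to its norm, and pairing with the vacuum is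
`⟨0|`. Adjointness therefore turns components of `e^{-B}|0⟩` into amplitudes of `e^{B̃}` for the
same `r`. -/
theorem formalExp_neg_B_vacuum [CharZero K] (r : ℤ → K) {x : OddIdx → Times}
    (hx : Function.Injective x) (d : Times →₀ ℕ) (S : Finset ℕ) :
    normSq K S *
        MvPowerSeries.coeff d (formalExp K (-linearSeries x (B r))) (vacuum K) S =
      MvPowerSeries.coeff d (amplitude r x S) := by
  have h := (isSeriesAdjoint_linearSeries r hx).formalExp
    (constantCoeff_neg_linearSeries _) (constantCoeff_linearSeries _) d
    (vacuum K) (Finsupp.single S 1)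
  have h0 : normSq K ∅ = 1 := if_neg (notMem_empty 0)
  rw [pairing_single_right, vacuum, pairing_single, h0, one_mul] at h
  exact h

end Adjoint

/-! ### Strict partitions as finite sets of even size. -/

section StrictPartitions

namespace StrictPartition

/-- The parts, with a zero appended when their number is odd. -/
def evenParts (p : StrictPartition) : List ℕ :=
  if Even p.length then p.parts else p.parts ++ [0]

theorem zero_notMem_parts (p : StrictPartition) : 0 ∉ p.parts := fun h => lt_irrefl 0 (p.pos 0 h)

theorem evenParts_pairwise (p : StrictPartition) : p.evenParts.Pairwise (· > ·) := by
  rw [evenParts]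
  split_ifs
  · exact p.decreasing
  · rw [List.pairwise_append]
    refine ⟨p.decreasing, List.pairwise_singleton _ _, fun a ha b hb => ?_⟩
    rw [List.mem_singleton] at hb
    subst hb
    exact p.pos a ha

theorem evenParts_injective : Function.Injective fun p : StrictPartition => p.evenParts.toFinset := by
  intro p p' h
  -- Discarding a possible zero recovers the partition.
  have hfilter : ∀ p : StrictPartition, p.evenParts.filter (fun n => 0 < n) = p.parts := by
    intro p
    have h1 : p.parts.filter (fun n => 0 < n) = p.parts :=
      List.filter_eq_self.mpr fun n hn => by simpa using p.pos n hn
    rw [evenParts]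
    split_ifs
    · exact h1
    · rw [List.filter_append, h1]; simp
  have hperm : p.evenParts.Perm p'.evenParts :=
    (List.perm_ext_iff_of_nodup (p.evenParts_pairwise.imp ne_of_gt)
      (p'.evenParts_pairwise.imp ne_of_gt)).mpr fun a => by
        have := congrArg (a ∈ ·) h
        simpa using this
  have heq : p.evenParts = p'.evenParts :=
    hperm.eq_of_pairwise (fun a b _ _ h1 h2 => absurd h1 (not_lt.mpr (le_of_lt h2)))
      p.evenParts_pairwise p'.evenParts_pairwise
  ext1
  rw [← hfilter p, ← hfilter p', heq]

/-- The positive elements of `S` are the parts; as `#S` is even, their number is odd exactly when `0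
∈ S`, which is when a zero is appended. -/
theorem exists_evenParts_eq {S : Finset ℕ} (hS : Even #S) :
    ∃ p : StrictPartition, p.evenParts.toFinset = S := by
  let l := (S.filter (0 < ·)).sort (· ≥ ·)
  have hl : l.toFinset = S.filter (0 < ·) := sort_toFinset ..
  have hlen : l.length = #(S.filter (0 < ·)) := length_sort ..
  refine ⟨⟨l, ?_, fun n hn => ?_⟩, ?_⟩
  · exact sortedGT_sort _ |>.pairwise
  · rw [← List.mem_toFinset, hl] at hn
    exact (mem_filter.mp hn).2
  · have hcase : S.filter (0 < ·) = S.erase 0 := by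
      ext n
      simp [Nat.pos_iff_ne_zero, and_comm]
    rw [evenParts, length]
    by_cases h0 : 0 ∈ S
    · have hc : l.length + 1 = #S := by rw [hlen, hcase, card_erase_add_one h0]
      rw [if_neg (by rw [← hc, Nat.even_add_one] at hS; exact hS), List.toFinset_append, hl, hcase]
      ext n
      by_cases hn : n = 0 <;> simp [hn, h0]
    · have hc : l.length = #S := by rw [hlen, hcase, erase_eq_of_notMem h0]
      rw [if_pos (by rw [hc]; exact hS), hl, hcase, erase_eq_of_notMem h0]

variable {K : Type*} [Field K]

theorem halfQ_eq (p : StrictPartition) (x : OddIdx → Times) :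
    p.halfQ K x = halfSubst K x (pfaffian (Q₂ K) p.evenParts) := rfl

theorem prod_evenParts (p : StrictPartition) (r : ℤ → K) :
    (p.evenParts.map fun n : ℕ => ∏ j ∈ Icc 1 n, r (j : ℤ)).prod = p.content r := by
  rw [evenParts, content]
  split_ifs <;> simp

theorem content_mul (p : StrictPartition) (r r' : ℤ → K) :
    p.content (r * r') = p.content r * p.content r' := by
  rw [content, content, content, ← List.prod_map_mul]
  simp only [Pi.mul_apply, prod_mul_distrib]

theorem content_of_eq_one (p : StrictPartition) (r : ℤ → K) (hr : ∀ n, r n = 1) :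
    p.content r = 1 := by
  rw [content]
  simp [hr]

/-- Each of the two amplitudes brings `2^{-m/2}`, with `m` the padded length. If a zero was appended
then `m = l(λ) + 1`, and the inverse norm `2` of the basis vector compensates. -/
theorem normSq_evenParts [CharZero K] (p : StrictPartition) :
    (normSq K p.evenParts.toFinset)⁻¹ * ((2⁻¹ : K) ^ (p.evenParts.length / 2) *
      (2⁻¹ : K) ^ (p.evenParts.length / 2)) = (2⁻¹ : K) ^ p.length := by
  rw [← pow_add, evenParts, normSq]
  by_cases h : Even p.length
  · rw [if_pos h, if_neg (by simpa using p.zero_notMem_parts), inv_one, one_mul]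
    obtain ⟨m, hm⟩ := h
    congr 1
    rw [length] at hm ⊢
    omega
  · rw [if_neg h, if_pos (by simp), List.length_append, List.length_singleton]
    rw [Nat.not_even_iff_odd] at h
    obtain ⟨m, hm⟩ := h
    rw [length] at hm ⊢
    rw [show (p.parts.length + 1) / 2 + (p.parts.length + 1) / 2 = p.parts.length + 1 by omega,
      pow_succ]
    field_simp

theorem coeff_amplitude_evenParts [CharZero K] {rt : ℤ → K} (hrt : ∀ n, rt n = rt (1 - n))
    {x : OddIdx → Times} (hx : Function.Injective x) (hi : ∀ k, timeIndex (x k) = k.1)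
    (p : StrictPartition) (d : Times →₀ ℕ) :
    MvPowerSeries.coeff d (amplitude rt x p.evenParts.toFinset) =
      (2⁻¹ : K) ^ (p.evenParts.length / 2) * p.content rt *
        MvPowerSeries.coeff d (p.halfQ K x) := by
  rw [amplitude_toFinset hrt hx hi _ p.evenParts_pairwise, MvPowerSeries.coeff_C_mul,
    prod_evenParts, halfQ_eq]

end StrictPartition

end StrictPartitions

/-! ### Summation over intermediate states. -/

section Cauchy

variable {K : Type*} [Field K]

theorem coeff_cauchyTerm (p : StrictPartition) (d : Times →₀ ℕ) :
    MvPowerSeries.coeff d (p.cauchyTerm K) = (2⁻¹ : K) ^ p.length *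
      ∑ e ∈ antidiagonal d, MvPowerSeries.coeff e.1 (p.halfQ K Sum.inl) *
        MvPowerSeries.coeff e.2 (p.halfQ K Sum.inr) := by
  rw [StrictPartition.cauchyTerm, coeff_smul_field, smul_eq_mul, MvPowerSeries.coeff_mul]

variable [CharZero K]

theorem amplitude_of_odd {rt : ℤ → K} (hrt : ∀ n, rt n = rt (1 - n))
    {x : OddIdx → Times} (hx : Function.Injective x) (hi : ∀ k, timeIndex (x k) = k.1)
    {S : Finset ℕ} (hS : ¬ Even #S) : amplitude rt x S = 0 := by
  have hl : (S.sort (· ≥ ·)).Pairwise (· > ·) := (sortedGT_sort _).pairwise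
  have h := amplitude_toFinset hrt hx hi _ hl
  rw [sort_toFinset, pfaffian_of_odd _ _ _ rfl (by rwa [length_sort, ← Nat.not_even_iff_odd]),
    map_zero, mul_zero] at h
  exact h

theorem normSq_ne_zero (S : Finset ℕ) : normSq K S ≠ 0 := by
  rw [normSq]
  split_ifs <;> norm_num

/-- For fixed `d` these amplitudes are rescaled components of one vector of the Fock space, which
has finite support. -/
theorem finite_support_amplitude (r : ℤ → K) {x : OddIdx → Times} (hx : Function.Injective x)
    (d : Times →₀ ℕ) :
    (Function.support fun S => MvPowerSeries.coeff d (amplitude r x S)).Finite := by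
  refine (MvPowerSeries.coeff d (formalExp K (-linearSeries x (B r)))
    (vacuum K)).support.finite_toSet.subset fun S hS => ?_
  rw [mem_coe, Finsupp.mem_support_iff]
  intro h
  refine hS ?_
  change MvPowerSeries.coeff d (amplitude r x S) = 0
  rw [← formalExp_neg_B_vacuum r hx, h, mul_zero]

/-- Expand `e^{-B}|0⟩` in the basis and convert its components into amplitudes; the inverse norm is
the price of the conversion. -/
theorem coeff_vacuumExpectation (rt r : ℤ → K) (d : Times →₀ ℕ) :
    MvPowerSeries.coeff d (vacuumExpectation rt r) =
      ∑ p ∈ antidiagonal d, ∑ᶠ S, (normSq K S)⁻¹ *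
        (MvPowerSeries.coeff p.1 (amplitude rt Sum.inl S) *
          MvPowerSeries.coeff p.2 (amplitude r Sum.inr S)) := by
  change vev K (MvPowerSeries.coeff d _) = _
  rw [MvPowerSeries.coeff_mul, map_sum]
  refine sum_congr rfl fun p _ => ?_
  rw [vev_apply, Module.End.mul_apply]
  set v := MvPowerSeries.coeff p.2 (formalExp K (-linearSeries Sum.inr (B r))) (vacuum K) with hv
  set T := MvPowerSeries.coeff p.1 (formalExp K (linearSeries Sum.inl (Btilde rt))) with hT
  have hsum : covacuum K (T v) =
      ∑ S ∈ v.support, v S * MvPowerSeries.coeff p.1 (amplitude rt Sum.inl S) := by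
    conv_lhs => rw [← Finsupp.sum_single v, Finsupp.sum, map_sum, map_sum]
    refine sum_congr rfl fun S _ => ?_
    rw [single_eq_smul, map_smul, map_smul, smul_eq_mul]
    rfl
  have hvS : ∀ S, v S = (normSq K S)⁻¹ * MvPowerSeries.coeff p.2 (amplitude r Sum.inr S) :=
    fun S => by
      rw [← formalExp_neg_B_vacuum r Sum.inr_injective, inv_mul_cancel_left₀ (normSq_ne_zero S)]
  rw [hsum, finsum_eq_sum_of_support_subset (s := v.support)]
  · refine sum_congr rfl fun S _ => ?_
    rw [hvS]
    ring
  · intro S hS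
    rw [mem_coe, Finsupp.mem_support_iff]
    intro h
    refine hS ?_
    rw [hvS] at h
    change (normSq K S)⁻¹ * (_ * _) = 0
    rw [mul_left_comm, h, mul_zero]

/-- Read off from the fermions with `r = 1`, where the content is `1` and `Q_λ(t/2)` is a nonzero
multiple of an amplitude. -/
theorem finite_support_halfQ {x : OddIdx → Times} (hx : Function.Injective x)
    (hi : ∀ k, timeIndex (x k) = k.1) (d : Times →₀ ℕ) :
    {p : StrictPartition | MvPowerSeries.coeff d (p.halfQ K x) ≠ 0}.Finite := by
  have hfin := (finite_support_amplitude (1 : ℤ → K) hx d).preimage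
    (StrictPartition.evenParts_injective.injOn)
  refine hfin.subset fun p hp => ?_
  change MvPowerSeries.coeff d (amplitude (1 : ℤ → K) x p.evenParts.toFinset) ≠ 0
  rw [p.coeff_amplitude_evenParts (fun _ => rfl) hx hi, p.content_of_eq_one 1 fun _ => rfl]
  exact mul_ne_zero (mul_ne_zero (pow_ne_zero _ (by norm_num)) one_ne_zero) hp

theorem formallySummable_cauchyTerm :
    FormallySummable fun p : StrictPartition => p.cauchyTerm K := by
  intro d
  refine ((antidiagonal d).finite_toSet.biUnion fun e _ =>
    finite_support_halfQ (K := K) Sum.inl_injective (fun _ => rfl) e.1).subset fun p hp => ?_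
  by_contra h
  simp only [Set.mem_iUnion, not_exists, Set.mem_ofPred_eq, ne_eq, not_not, mem_coe] at h
  refine hp ?_
  rw [coeff_cauchyTerm, sum_eq_zero, mul_zero]
  intro e he
  rw [h e he, zero_mul]

theorem formallySummable_content_smul_cauchyTerm (r : ℤ → K) :
    FormallySummable fun p : StrictPartition => p.content r • p.cauchyTerm K := by
  intro d
  refine (formallySummable_cauchyTerm (K := K) d).subset fun p hp h => hp ?_
  change p.content r • MvPowerSeries.coeff d (p.cauchyTerm K) = 0
  rw [h, smul_zero]

theorem vacuumExpectation_eq_formalSum {rt r : ℤ → K} (hr : ∀ n, r n = r (1 - n))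
    (hrt : ∀ n, rt n = rt (1 - n)) :
    vacuumExpectation rt r =
      formalSum fun p : StrictPartition => p.content (rt * r) • p.cauchyTerm K := by
  ext d
  rw [coeff_vacuumExpectation]
  change _ = ∑ᶠ p : StrictPartition, MvPowerSeries.coeff d (p.content (rt * r) • p.cauchyTerm K)
  have hS : ∀ e : (Times →₀ ℕ) × (Times →₀ ℕ), ∑ᶠ S, (normSq K S)⁻¹ *
        (MvPowerSeries.coeff e.1 (amplitude rt Sum.inl S) *
          MvPowerSeries.coeff e.2 (amplitude r Sum.inr S)) =
      ∑ᶠ p : StrictPartition, p.content (rt * r) * ((2⁻¹ : K) ^ p.length *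
        (MvPowerSeries.coeff e.1 (p.halfQ K Sum.inl) *
          MvPowerSeries.coeff e.2 (p.halfQ K Sum.inr))) := by
    intro e
    have hp : ∀ p : StrictPartition, p.content (rt * r) * ((2⁻¹ : K) ^ p.length *
        (MvPowerSeries.coeff e.1 (p.halfQ K Sum.inl) *
          MvPowerSeries.coeff e.2 (p.halfQ K Sum.inr))) = (normSq K p.evenParts.toFinset)⁻¹ *
        (MvPowerSeries.coeff e.1 (amplitude rt Sum.inl p.evenParts.toFinset) *
          MvPowerSeries.coeff e.2 (amplitude r Sum.inr p.evenParts.toFinset)) := by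
      intro p
      rw [p.coeff_amplitude_evenParts hrt Sum.inl_injective (fun _ => rfl),
        p.coeff_amplitude_evenParts hr Sum.inr_injective (fun _ => rfl), p.content_mul,
        ← p.normSq_evenParts]
      ring
    simp only [hp]
    -- The sum over all finite sets reduces to the range of the injection `evenParts`, since sets of
    -- odd size have zero amplitude.
    rw [← finsum_mem_range (f := fun S => (normSq K S)⁻¹ *
        (MvPowerSeries.coeff e.1 (amplitude rt Sum.inl S) *
          MvPowerSeries.coeff e.2 (amplitude r Sum.inr S))) StrictPartition.evenParts_injective,
      ← finsum_mem_univ]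
    refine finsum_mem_inter_support_eq _ _ _ ?_
    refine (Set.inter_eq_right.mpr (Set.subset_univ _)).trans
      (Set.inter_eq_right.mpr fun S hS => ?_).symm
    by_contra h
    refine hS ?_
    change (normSq K S)⁻¹ * (_ * _) = 0
    rw [amplitude_of_odd hrt Sum.inl_injective (fun _ => rfl) fun hE =>
      h (StrictPartition.exists_evenParts_eq hE), map_zero, zero_mul, mul_zero]
  simp only [hS]
  rw [← finsum_sum_comm]
  · refine finsum_congr fun p => ?_
    rw [coeff_smul_field, coeff_cauchyTerm, smul_eq_mul, mul_sum, mul_sum]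
  · intro e _
    refine (finite_support_halfQ (K := K) Sum.inl_injective (fun _ => rfl) e.1).subset
      fun p hp h => hp ?_
    change _ * (_ * (_ * _)) = 0
    rw [h, zero_mul, mul_zero, mul_zero]

end Cauchy

/-! ### The Heisenberg relations for `r = r̃ = 1`. -/

section Heisenberg

variable {K : Type*} [Field K] [CharZero K]

theorem Btilde_one_phi_apply (k : OddIdx) (n : ℤ) (v : Fock K) :
    Btilde 1 k (phi K n v) = phi K (n - k.1) v + phi K n (Btilde 1 k v) := by
  rw [Btilde_phi_apply _ fun _ => rfl]
  simp [fallingProd]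

theorem odd_ne_zero (k : OddIdx) : ((k.1 : ℕ) : ℤ) ≠ 0 := by
  have := k.2.pos
  omega

theorem B_one_phi_apply (k : OddIdx) (n : ℤ) (v : Fock K) :
    B 1 k (phi K n v) = -phi K (n + k.1) v + phi K n (B 1 k v) := by
  rw [B, bilinear_phi_apply _ (odd_ne_zero k), add_comm (k.1 : ℤ) n]
  congr 1
  have hneg : -phi K (n + k.1) v = (-1 : K) • phi K (n + k.1) v := (neg_one_smul K _).symm
  rw [hneg]
  congr 1
  simp only [Pi.one_apply, prod_const_one, mul_one]
  rw [zpow_add₀ (by norm_num), zpow_natCast, k.2.neg_one_pow, neg_one_zpow_neg]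
  have := neg_one_zpow_mul_self (K := K) n
  linear_combination -this

/-- On fermions the two operators act by index shifts in opposite directions, and shifts commute. So
`[B̃_k, B_l]` commutes with every `φ_n` and is determined by its value on the vacuum. -/
theorem commutator_phi_apply (k l : OddIdx) (n : ℤ) (v : Fock K) :
    Btilde 1 k (B 1 l (phi K n v)) - B 1 l (Btilde 1 k (phi K n v)) =
      phi K n (Btilde 1 k (B 1 l v) - B 1 l (Btilde 1 k v)) := by
  simp only [B_one_phi_apply, Btilde_one_phi_apply, map_add, map_neg, map_sub]
  rw [show n + (l.1 : ℤ) - k.1 = n - k.1 + l.1 by ring]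
  abel

/-- The coefficient of `|0⟩` in `(-1)^n φ_n φ_{-n} |0⟩`. -/
def vacuumWeight (K : Type*) [Field K] (n : ℤ) : K :=
  if n < 0 then 1 else if n = 0 then 2⁻¹ else 0

theorem phi_phi_neg_vacuum (n : ℤ) :
    phi K n (phi K (-n) (vacuum K)) = ((-1) ^ n * vacuumWeight K n) • vacuum K := by
  rw [vacuumWeight]
  rcases lt_trichotomy n 0 with h | rfl | h
  · rw [phi_phi_apply, if_pos (by ring), phi_vacuum h, map_zero, sub_zero, if_pos h, mul_one]
  · have h := phi_phi_apply (K := K) 0 0 (vacuum K)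
    rw [if_pos (by ring), eq_sub_iff_add_eq, ← two_smul K] at h
    rw [neg_zero, if_neg (lt_irrefl _), if_pos rfl]
    calc phi K 0 (phi K 0 (vacuum K))
        = (2⁻¹ : K) • ((2 : K) • phi K 0 (phi K 0 (vacuum K))) := by
          rw [smul_smul, inv_mul_cancel₀ two_ne_zero, one_smul]
      _ = _ := by rw [h, smul_smul, mul_comm]
  · rw [phi_vacuum (by omega), map_zero, if_neg (by omega), if_neg (by omega), mul_zero,
      zero_smul]

/-- A step function minus its translate by `k` cannot be summed as two separate series; the finite
difference contributes `-1/2` at each of the `k - 1` interior points and `-1/4` at the end points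
`0` and `k`. -/
theorem finsum_vacuumWeight_sub (k : ℕ) :
    ∑ᶠ n : ℤ, (2⁻¹ : K) * (vacuumWeight K n - vacuumWeight K (n - k)) = -(2⁻¹ * k) := by
  rw [finsum_eq_sum_of_support_subset (s := Icc (0 : ℤ) k)]
  · have h : ∀ n ∈ Icc (0 : ℤ) k, (2⁻¹ : K) * (vacuumWeight K n - vacuumWeight K (n - k)) =
        (if n < k then -(2⁻¹ * 2⁻¹) else 0) + (if 0 < n then -(2⁻¹ * 2⁻¹) else 0) := by
      intro n hn
      rw [mem_Icc] at hn
      rw [vacuumWeight, vacuumWeight]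
      split_ifs <;> first | omega | norm_num
    have h1 : (Icc (0 : ℤ) k).filter (· < (k : ℤ)) = Ico 0 (k : ℤ) := by
      ext; simp; omega
    have h2 : (Icc (0 : ℤ) k).filter (0 < ·) = Ioc 0 (k : ℤ) := by
      ext; simp; omega
    rw [sum_congr rfl h, sum_add_distrib, ← sum_filter, ← sum_filter, h1, h2, sum_const, sum_const,
      Int.card_Ico, Int.card_Ioc]
    simp
    ring
  · intro n hn
    rw [coe_Icc, Set.mem_Icc]
    by_contra h
    refine hn ?_
    change (2⁻¹ : K) * (vacuumWeight K n - vacuumWeight K (n - k)) = 0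
    rw [vacuumWeight, vacuumWeight]
    split_ifs <;> first | omega | norm_num

/-- The sum has the form `∑ (f(n) - f(n - k))`. For `k ≠ l` the function `f` has finite support and
the sum vanishes by translation. For `k = l` it is nonzero at every negative `n`, and the central
term survives. -/
theorem Btilde_B_vacuum (k l : OddIdx) :
    Btilde 1 k (B 1 l (vacuum K)) = (if k = l then -(2⁻¹ * (k.1 : K)) else 0) • vacuum K := by
  rw [B, bilinear_apply _ (odd_ne_zero l),
    map_finsum _ (finite_support_bilinear _ (odd_ne_zero l) _)]
  have hsign : ∀ n : ℤ, (-1 : K) ^ (n - k.1) = -(-1) ^ n := fun n => by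
    rw [sub_eq_add_neg, zpow_add₀ (by norm_num), neg_one_zpow_neg, zpow_natCast,
      k.2.neg_one_pow, mul_neg_one]
  let f : ℤ → Fock K := fun n =>
    (2⁻¹ * (-1) ^ n : K) • phi K n (phi K ((l.1 : ℤ) - k.1 - n) (vacuum K))
  have hterm : ∀ n : ℤ, Btilde 1 k ((2⁻¹ * ((-1) ^ n * ∏ i ∈ range l.1, (1 : ℤ → K) (n - i))) •
      phi K n (phi K ((l.1 : ℤ) - n) (vacuum K))) = f n - f (n - k.1) := by
    intro n
    simp only [Pi.one_apply, prod_const_one, mul_one, f, map_smul, Btilde_one_phi_apply,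
      Btilde_vacuum, map_zero, add_zero, hsign]
    rw [show (l.1 : ℤ) - n - k.1 = l.1 - k.1 - n by ring,
      show (l.1 : ℤ) - k.1 - (n - k.1) = l.1 - n by ring]
    module
  rw [finsum_congr hterm]
  by_cases hkl : k = l
  · subst hkl
    have hf : ∀ n, f n = (2⁻¹ * vacuumWeight K n) • vacuum K := fun n => by
      simp only [f]
      rw [show (k.1 : ℤ) - k.1 - n = -n by ring, phi_phi_neg_vacuum, smul_smul]
      congr 1
      have := neg_one_zpow_mul_self (K := K) n
      linear_combination 2⁻¹ * vacuumWeight K n * this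
    rw [if_pos rfl, ← finsum_vacuumWeight_sub, finsum_smul]
    refine finsum_congr fun n => ?_
    rw [hf, hf]
    module
  · have hne : (l.1 : ℤ) - k.1 ≠ 0 := fun h => hkl (Subtype.ext (by omega))
    have hfin : (Function.support f).Finite :=
      finite_support_bilinear (fun n => 2⁻¹ * (-1) ^ n) hne (vacuum K)
    have hfin' : (Function.support fun n => f (n - k.1)).Finite :=
      hfin.preimage (f := fun n : ℤ => n - k.1) (sub_left_injective.injOn)
    rw [if_neg hkl, zero_smul, finsum_sub_distrib hfin hfin', sub_eq_zero]
    exact (finsum_comp_equiv (Equiv.subRight (k.1 : ℤ)) (f := f)).symm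

/-- The Heisenberg commutation relations. -/
theorem heisenberg (k l : OddIdx) (v : Fock K) :
    Btilde 1 k (B 1 l v) - B 1 l (Btilde 1 k v) =
      (if k = l then -(2⁻¹ * (k.1 : K)) else 0) • v := by
  induction v using Finsupp.induction_linear with
  | zero => simp
  | add f g hf hg =>
    rw [smul_add, ← hf, ← hg]
    simp only [map_add]
    abel
  | single S c =>
    -- Write the basis vector as a product of fermions on the vacuum, then move the commutator
    -- through the product.
    have hS := prod_phi_vacuum (K := K) _ (sortedGT_sort S).pairwise
    rw [sort_toFinset] at hS
    rw [single_eq_smul, ← hS]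
    simp only [map_smul]
    rw [← smul_sub, smul_comm]
    congr 1
    generalize S.sort (· ≥ ·) = m
    induction m with
    | nil =>
      rw [List.map_nil, List.prod_nil, Module.End.one_apply, Btilde_vacuum, map_zero, sub_zero,
        Btilde_B_vacuum]
    | cons n m ih =>
      rw [List.map_cons, List.prod_cons, Module.End.mul_apply, commutator_phi_apply, ih, map_smul]

end Heisenberg

/-! ### The Cauchy kernel as a Heisenberg vacuum expectation. -/

section Kernel

theorem mul_pow_of_heisenberg {E : Type*} [Ring E] {X Y Z : E} (hXY : X * Y = Y * X + Z)
    (hZ : Commute Z Y) (N : ℕ) :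
    X * Y ^ (N + 1) = Y ^ (N + 1) * X + (N + 1) • (Z * Y ^ N) := by
  induction N with
  | zero => simpa using hXY
  | succ N ih =>
    rw [pow_succ, ← mul_assoc, ih, add_mul, mul_assoc, hXY, smul_mul_assoc, mul_assoc Z, ← pow_succ,
      mul_add, ← (hZ.pow_right (N + 1)).eq, ← mul_assoc, ← pow_succ, succ_nsmul (Z * _) (N + 1)]
    abel

/-- Vacuum expectation values of monomials in a Heisenberg pair. -/
theorem vev_pow_mul_pow {R E : Type*} [CommRing R] [Ring E] (κ : R →+* E)
    (hκ : ∀ r e, κ r * e = e * κ r) (v : E →+ R) (hv : ∀ r e, v (κ r * e) = r * v e)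
    (hv1 : v 1 = 1) {X Y : E} {Z : R} (hXY : X * Y = Y * X + κ Z) (hX : ∀ e, v (e * X) = 0)
    (hY : ∀ e, v (Y * e) = 0) (M N : ℕ) :
    v (X ^ M * Y ^ N) = if M = N then N.factorial * Z ^ N else 0 := by
  induction M generalizing N with
  | zero =>
    rcases N with _ | N
    · simp [hv1]
    · rw [pow_zero, one_mul, pow_succ', hY, if_neg (by omega)]
  | succ M ih =>
    rcases N with _ | N
    · rw [pow_zero, mul_one, pow_succ, hX, if_neg (by omega)]
    · rw [pow_succ, mul_assoc, mul_pow_of_heisenberg hXY (hκ Z Y), mul_add, ← mul_assoc, map_add,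
        hX, zero_add, mul_smul_comm, map_nsmul, ← mul_assoc, ← hκ, mul_assoc, hv, ih]
      by_cases h : M = N
      · subst h
        rw [if_pos rfl, if_pos rfl, Nat.factorial_succ, nsmul_eq_mul, pow_succ]
        push_cast
        ring
      · rw [if_neg h, if_neg (by omega), mul_zero, smul_zero]

variable {K : Type*} [Field K]

/-- The exponent of the Cauchy kernel. -/
def kernelExponent (K : Type*) [Field K] : MvPowerSeries Times K :=
  formalSum fun n : OddIdx =>
    ((2⁻¹ : K) * n.1) • (MvPowerSeries.X (Sum.inl n) * MvPowerSeries.X (Sum.inr n))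

/-- Written over all splittings of `d` so as to match, term by term, the commutators of coefficients
of `B̃(t)` and `-B(t*)`. -/
theorem coeff_kernelExponent (d : Times →₀ ℕ) :
    MvPowerSeries.coeff d (kernelExponent K) = ∑ p ∈ antidiagonal d, ∑ᶠ n : OddIdx,
      2⁻¹ * (n.1 : K) * (MvPowerSeries.coeff p.1 (MvPowerSeries.X (R := K) (Sum.inl n)) *
        MvPowerSeries.coeff p.2 (MvPowerSeries.X (R := K) (Sum.inr n))) := by
  rw [← finsum_sum_comm]
  · refine finsum_congr fun n => ?_
    rw [coeff_smul_field, MvPowerSeries.coeff_mul, smul_eq_mul, mul_sum]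
  · intro p _
    refine Set.Subsingleton.finite fun m hm n hn => ?_
    by_contra hmn
    have hX : ∀ n : OddIdx, n ∈ (Function.support fun n : OddIdx =>
        2⁻¹ * (n.1 : K) * (MvPowerSeries.coeff p.1 (MvPowerSeries.X (R := K) (Sum.inl n)) *
          MvPowerSeries.coeff p.2 (MvPowerSeries.X (R := K) (Sum.inr n)))) →
        p.1 = Finsupp.single (Sum.inl n) 1 := by
      intro n hn
      by_contra h
      refine hn ?_
      dsimp only
      rw [MvPowerSeries.coeff_X, if_neg h, zero_mul, mul_zero]
    exact hmn (Sum.inl_injective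
      (Finsupp.single_left_injective one_ne_zero ((hX m hm).symm.trans (hX n hn))))

theorem constantCoeff_kernelExponent :
    MvPowerSeries.constantCoeff (kernelExponent K) = 0 := by
  rw [← MvPowerSeries.coeff_zero_eq_constantCoeff_apply, coeff_kernelExponent]
  refine sum_eq_zero fun p hp => finsum_eq_zero_of_forall_eq_zero fun n => ?_
  rw [HasAntidiagonal.mem_antidiagonal, add_eq_zero] at hp
  rw [hp.1, MvPowerSeries.coeff_X, if_neg, zero_mul, mul_zero]
  exact fun h => one_ne_zero (Finsupp.single_eq_zero.mp h.symm)

theorem commutator_coeff [CharZero K] (u w : Times →₀ ℕ) :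
    MvPowerSeries.coeff u (linearSeries Sum.inl (Btilde (1 : ℤ → K))) *
        MvPowerSeries.coeff w (-linearSeries Sum.inr (B (1 : ℤ → K))) =
      MvPowerSeries.coeff w (-linearSeries Sum.inr (B (1 : ℤ → K))) *
        MvPowerSeries.coeff u (linearSeries Sum.inl (Btilde (1 : ℤ → K))) +
      algebraMap K (Module.End K (Fock K)) (∑ᶠ n : OddIdx,
        2⁻¹ * (n.1 : K) * (MvPowerSeries.coeff u (MvPowerSeries.X (R := K) (Sum.inl n)) *
          MvPowerSeries.coeff w (MvPowerSeries.X (R := K) (Sum.inr n)))) := by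
  rw [map_neg]
  by_cases hu : ∃ k, u = Finsupp.single (Sum.inl k) 1
  · obtain ⟨k, rfl⟩ := hu
    have hX : ∀ n : OddIdx, n ≠ k → MvPowerSeries.coeff (Finsupp.single (Sum.inl k) 1)
        (MvPowerSeries.X (R := K) (Sum.inl n : Times)) = 0 := fun n hn => by
      rw [MvPowerSeries.coeff_X, if_neg]
      exact fun h => hn (Sum.inl_injective (Finsupp.single_left_injective one_ne_zero h)).symm
    rw [finsum_eq_single _ k fun n hn => by rw [hX n hn, zero_mul, mul_zero],
      MvPowerSeries.coeff_X, if_pos rfl, one_mul, coeff_linearSeries_single Sum.inl_injective]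
    by_cases hw : ∃ l, w = Finsupp.single (Sum.inr l) 1
    · obtain ⟨l, rfl⟩ := hw
      rw [coeff_linearSeries_single Sum.inr_injective, MvPowerSeries.coeff_X]
      have hif : (2⁻¹ * (k.1 : K) * if Finsupp.single (Sum.inr l : Times) 1 =
          Finsupp.single (Sum.inr k) 1 then 1 else 0) =
          -(if k = l then -(2⁻¹ * (k.1 : K)) else 0) := by
        by_cases hkl : k = l
        · subst hkl; simp
        · rw [if_neg hkl, if_neg, mul_zero, neg_zero]
          exact fun h =>
            hkl (Sum.inr_injective (Finsupp.single_left_injective one_ne_zero h)).symm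
      rw [hif]
      refine LinearMap.ext fun v => ?_
      have h' := heisenberg k l v
      simp only [LinearMap.add_apply, Module.End.mul_apply, Module.algebraMap_end_apply,
        LinearMap.neg_apply, map_neg, ← h']
      abel
    · push Not at hw
      rw [coeff_linearSeries_of_ne _ hw, MvPowerSeries.coeff_X, if_neg (hw k)]
      exact LinearMap.ext fun v => by simp
  · push Not at hu
    rw [coeff_linearSeries_of_ne _ hu, finsum_eq_zero_of_forall_eq_zero fun n => by
      rw [MvPowerSeries.coeff_X, if_neg (hu n), zero_mul, mul_zero]]
    simp

theorem linearSeries_mul_linearSeries [CharZero K] :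
    linearSeries Sum.inl (Btilde (1 : ℤ → K)) * (-linearSeries Sum.inr (B (1 : ℤ → K))) =
      (-linearSeries Sum.inr (B (1 : ℤ → K))) * linearSeries Sum.inl (Btilde (1 : ℤ → K)) +
        scalarSeries K (kernelExponent K) := by
  ext1 d
  rw [map_add, MvPowerSeries.coeff_mul, coeff_mul_swap, coeff_scalarSeries, coeff_kernelExponent,
    map_sum, ← sum_add_distrib]
  exact sum_congr rfl fun p _ => commutator_coeff p.1 p.2

/-- The adjoint form of `B̃_k|0⟩ = 0`, namely `⟨0|B_k = 0`. -/
theorem covacuum_coeff_neg_B [CharZero K] (r : ℤ → K) (d : Times →₀ ℕ) (v : Fock K) :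
    covacuum K (MvPowerSeries.coeff d (-linearSeries Sum.inr (B r)) v) = 0 := by
  have h := isSeriesAdjoint_linearSeries r Sum.inr_injective d v (vacuum K)
  rw [coeff_linearSeries_Btilde_vacuum Sum.inr_injective, map_zero, vacuum,
    pairing_single_right] at h
  have h0 : normSq K ∅ = 1 := if_neg (notMem_empty 0)
  rwa [h0, one_mul] at h

theorem vevSeries_smul (c : K) (P : MvPowerSeries Times (Module.End K (Fock K))) :
    vevSeries K (c • P) = c • vevSeries K P := by
  ext d
  exact map_smul (vev K) c (MvPowerSeries.coeff d P)

theorem vacuumExpectation_one [CharZero K] :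
    vacuumExpectation (1 : ℤ → K) 1 = cauchyKernel K := by
  ext d
  have e : MvPowerSeries.coeff d
      (formalExp K (linearSeries Sum.inl (Btilde (1 : ℤ → K))) *
        formalExp K (-linearSeries Sum.inr (B (1 : ℤ → K)))) = _ :=
    coeff_formalExp_mul_formalExp (by exact constantCoeff_linearSeries _)
      (by exact constantCoeff_neg_linearSeries _) (Nat.lt_succ_self d.degree)
  have eZ : MvPowerSeries.coeff d (cauchyKernel K) =
      MvPowerSeries.coeff d (truncExp K d.degree.succ (kernelExponent K)) :=
    coeff_formalExp constantCoeff_kernelExponent (Nat.lt_succ_self _)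
  rw [eZ]
  refine (congrArg (vev K) e).trans ?_
  -- Only equal powers survive, and `N! Z^N / (N!)² = Z^N / N!` is the `N`-th term of the
  -- exponential of the central commutator `Z`.
  have hv : ∀ M N : ℕ, vevSeries K
      (((M.factorial : K)⁻¹ • linearSeries Sum.inl (Btilde (1 : ℤ → K)) ^ M) *
        ((N.factorial : K)⁻¹ • (-linearSeries Sum.inr (B (1 : ℤ → K))) ^ N)) =
      if M = N then (N.factorial : K)⁻¹ • kernelExponent K ^ N else 0 := by
    intro M N
    have hs : ((M.factorial : K)⁻¹ • linearSeries Sum.inl (Btilde (1 : ℤ → K)) ^ M) *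
        ((N.factorial : K)⁻¹ • (-linearSeries Sum.inr (B (1 : ℤ → K))) ^ N) =
        ((M.factorial : K)⁻¹ * (N.factorial : K)⁻¹) •
          (linearSeries Sum.inl (Btilde (1 : ℤ → K)) ^ M *
            (-linearSeries Sum.inr (B (1 : ℤ → K))) ^ N) := smul_mul_smul_comm _ _ _ _
    have hpow : vevSeries K (linearSeries Sum.inl (Btilde (1 : ℤ → K)) ^ M *
        (-linearSeries Sum.inr (B (1 : ℤ → K))) ^ N) =
        if M = N then N.factorial * kernelExponent K ^ N else 0 :=
      vev_pow_mul_pow (E := MvPowerSeries Times (Module.End K (Fock K))) (scalarSeries K)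
        scalarSeries_mul_comm (vevSeries K) vevSeries_scalarSeries_mul vevSeries_one
        linearSeries_mul_linearSeries
        (fun e => vevSeries_mul_eq_zero e _ (coeff_linearSeries_Btilde_vacuum Sum.inl_injective))
        (fun e => vevSeries_mul_eq_zero' _ e (covacuum_coeff_neg_B 1)) M N
    rw [hs, vevSeries_smul, hpow]
    split_ifs with h
    · subst h
      rw [← nsmul_eq_mul, ← Nat.cast_smul_eq_nsmul K, smul_smul, mul_assoc,
        inv_mul_cancel₀ (Nat.cast_ne_zero.mpr M.factorial_ne_zero), mul_one]
    · rw [smul_zero]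
  change MvPowerSeries.coeff d (vevSeries K (truncExp K _ _ * truncExp K _ _)) = _
  rw [truncExp, truncExp, truncExp, sum_mul_sum, map_sum]
  congr 1
  refine sum_congr rfl fun M hM => ?_
  rw [map_sum, sum_congr rfl fun N _ => hv M N, sum_ite_eq, if_pos hM]

end Kernel

end BKP

end

theorem proposition3 {K : Type*} [Field K] [CharZero K] (r rt : ℤ → K)
    (hr : ∀ n, r n = r (1 - n)) (hrt : ∀ n, rt n = rt (1 - n)) :
    (BKP.FormallySummable (fun p : BKP.StrictPartition =>
        p.content (rt * r) • p.cauchyTerm K) ∧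
      BKP.vacuumExpectation rt r =
        BKP.formalSum (fun p : BKP.StrictPartition => p.content (rt * r) • p.cauchyTerm K)) ∧
    ((∀ n, rt n * r n = 1) → BKP.vacuumExpectation rt r = BKP.cauchyKernel K) ∧
    (BKP.FormallySummable (fun p : BKP.StrictPartition => p.cauchyTerm K) ∧
      BKP.cauchyKernel K = BKP.formalSum (fun p : BKP.StrictPartition => p.cauchyTerm K)) := by
  have hone : ∀ s : ℤ → K, (∀ n, s n = 1) →
      (fun p : BKP.StrictPartition => p.content s • p.cauchyTerm K) = fun p => p.cauchyTerm K :=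
    fun s hs => funext fun p => by rw [p.content_of_eq_one s hs, one_smul]
  have hkernel : BKP.cauchyKernel K =
      BKP.formalSum (fun p : BKP.StrictPartition => p.cauchyTerm K) := by
    rw [← BKP.vacuumExpectation_one,
      BKP.vacuumExpectation_eq_formalSum (fun _ => rfl) (fun _ => rfl),
      hone (1 * 1) fun _ => mul_one 1]
  refine ⟨⟨BKP.formallySummable_content_smul_cauchyTerm _,
    BKP.vacuumExpectation_eq_formalSum hr hrt⟩, fun h => ?_,
    BKP.formallySummable_cauchyTerm, hkernel⟩
  -- The operators for general `r` and `r̃` need not be compared with those for `1`: the sum over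
  -- partitions sees only `r̃ r`.
  rw [hkernel, BKP.vacuumExpectation_eq_formalSum hr hrt, hone (rt * r) h]
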